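/- For a topological space $X$, let $VX$ be the space of continuous valuations on $X$, i.e. of maps $\nu:\mathcal O(X)\to[0,\infty]$ on the lattice of open sets that are strict ($\nu(\varnothing)=0$), monotone, modular ($\nu(U\cup W)+\nu(U\cap W)=\nu(U)+\nu(W)$) and Scott continuous ($\nu(\bigcup_\lambda U_\lambda)=\sup_\lambda\nu(U_\lambda)$ for directed families), with the topology generated by the sets $\{\nu:\nu(U)>r\}$ for $U$ open and $r\in[0,\infty)$. Let $HX$ be the space of closed subsets of $X$ (including $\varnothing$) with the lower Vietoris topology, generated by the sets $\{C: C\cap U\neq\varnothing\}$ for $U$ open. $V$ and $H$ are monads on the category $\mathbf{Top}$ of all topological spaces and continuous maps: - for $V$: $f_*\nu(U)=\nu(f^{-1}U)$, the unit is $x\mapsto\delta_x$, and the multiplication is $\mathcal E:VVX\to VX$, $(\mathcal E\xi)(U)=\int\nu(U)\,d\xi(\nu)$; - for $H$: $f_\sharp C=\overline{f(C)}$, the unit is $x\mapsto\overline{\{x\}}$, and the multiplication is $\mathcal U:HHX\to HX$, $\mathcal U(\mathcal C)=\overline{\bigcup\mathcal C}$. With $j_x:Y\to X\times Y$, $j_x(y)=(x,y)$,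 they carry the strengths $s:X\times VY\to V(X\times Y)$, $s(x,\nu)=(j_x)_*\nu$, and $s:X\times HY\to H(X\times Y)$, $s(x,C)=(j_x)_\sharp C$. For $T=V$ or $T=H$ with multiplication $\mu$, let $t:TX\times Y\to T(X\times Y)$ be the costrength obtained from $s$ by symmetry, and let $\nabla$ be the composite $TX\times TY\xrightarrow{s}T(TX\times Y)\xrightarrow{Tt}TT(X\times Y)\xrightarrow{\mu}T(X\times Y)$; for $T=V$, $\nabla(\nu,\rho)$ is the product valuation of $\nu$ and $\rho$. The support of $\nu\in VX$ is the unique closed set $\mathrm{supp}(\nu)\subseteq X$ that meets an open set $U$ if and only if $\nu(U)>0$; the maps $\mathrm{supp}:VX\to HX$ form a natural transformation $V\to H$. Then: 1. The support commutes with the strengths: $\mathrm{supp}\circ s=s\circ(\mathrm{id}_X\times\mathrm{supp})$ as maps $X\times VY\to H(X\times Y)$, for all topological spaces $X,Y$. 2. $V$ and $H$, with the monad units $1\to V1$, $1\to H1$ and the maps $\nabla$, are (lax) symmetric monoidal functors on $(\mathbf{Top},\times,1)$, and $\mathrm{supp}:V\to H$ is a monoidal natural transformation. In particular, for all $\nu\in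 VX$ and $\rho\in VY$, the support of the product valuation is the product of the supports: $\mathrm{supp}(\nabla(\nu,\rho))=\mathrm{supp}(\nu)\times\mathrm{supp}(\rho)$. 3. For the oplax monoidal structures $V(X\times Y)\to VX\times VY$ and $H(X\times Y)\to HX\times HY$ induced by the product projections $p_1,p_2$, $\mathrm{supp}$ is also an opmonoidal natural transformation. In particular, for every $\pi\in V(X\times Y)$, the supports of the marginals are the (closed) projections of the support: $\mathrm{supp}((p_i)_*\pi)=\overline{p_i(\mathrm{supp}\,\pi)}$ for $i=1,2$. -/

import Mathlib

open CategoryTheory MonoidalCategory TopologicalSpace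
open scoped ENNReal NNReal
universe u

set_option linter.unusedSectionVars false
set_option linter.unusedVariables false

/-- A continuous valuation on a topological space: a strict, monotone, modular and Scott continuous
map from the lattice of open sets to `[0, ∞]`. -/
structure ContValuation (X : Type u) [TopologicalSpace X] where
  toFun : Opens X → ℝ≥0∞
  map_bot' : toFun ⊥ = 0
  mono' : Monotone toFun
  modular' : ∀ U V : Opens X, toFun (U ⊔ V) + toFun (U ⊓ V) = toFun U + toFun V
  scott' : ∀ D : Set (Opens X), D.Nonempty → DirectedOn (· ≤ ·) D →
    toFun (sSup D) = ⨆ U ∈ D, toFun U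

namespace ContValuation

section Basic
variable {X : Type u} [TopologicalSpace X]

instance : CoeFun (ContValuation X) (fun _ => Opens X → ℝ≥0∞) := ⟨toFun⟩

theorem ext {ν ρ : ContValuation X} (h : ∀ U, ν U = ρ U) : ν = ρ := by
  cases ν; cases ρ; congr; funext U; exact h U

theorem scott_iSup (ν : ContValuation X) {ι : Type*} [Nonempty ι] (U : ι → Opens X)
    (hU : Directed (· ≤ ·) U) : ν (⨆ i, U i) = ⨆ i, ν (U i) := by
  have := ν.scott' (Set.range U) (Set.range_nonempty U) hU.directedOn_range
  rw [sSup_range, iSup_range] at this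
  exact this

/-- The subbasic open sets of the space of valuations. -/
def theta (U : Opens X) (r : ℝ≥0) : Set (ContValuation X) := {ν | (r : ℝ≥0∞) < ν U}

/-- The space `VX`: the topology generated by the sets `{ν | ν U > r}`, `U` open, `r ∈ [0, ∞)`. -/
instance : TopologicalSpace (ContValuation X) :=
  .generateFrom {S | ∃ (U : Opens X) (r : ℝ≥0), S = theta U r}

theorem lsc_eval (U : Opens X) : LowerSemicontinuous (fun ν : ContValuation X => ν U) := by
  rw [lowerSemicontinuous_iff_isOpen_preimage]
  intro y
  induction y with
  | top => simp
  | coe r => exact isOpen_generateFrom_of_mem ⟨U, r, rfl⟩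

theorem continuous_iff_lsc {Z : Type*} [TopologicalSpace Z] {F : Z → ContValuation X} :
    Continuous F ↔ ∀ U : Opens X, LowerSemicontinuous (fun z => F z U) := by
  constructor
  · intro h U
    exact (lsc_eval U).comp h
  · intro h
    rw [continuous_generateFrom_iff]
    rintro _ ⟨U, r, rfl⟩
    exact (h U).isOpen_preimage _

/-- The indicator function of an open set. -/
noncomputable def ind (U : Opens X) : X → ℝ≥0∞ := (U : Set X).indicator 1

/-- The (lower) integral `∫ g dν` of a lower semicontinuous function `g : X → [0, ∞]`: the supremum
of the sums `∑ i, r i * ν (U i)` over all simple functions `∑ i, r i • 1_{U i}` below `g`, where the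
`U i` are open and `r i ∈ [0, ∞]`. -/
noncomputable def lowerIntegral (ν : ContValuation X) (g : X → ℝ≥0∞) : ℝ≥0∞ :=
  ⨆ (n : ℕ) (r : Fin n → ℝ≥0∞) (U : Fin n → Opens X)
    (_ : ∀ x, ∑ i, r i * ind (U i) x ≤ g x), ∑ i, r i * ν (U i)

theorem lowerIntegral_mono (ν : ContValuation X) {g h : X → ℝ≥0∞} (hgh : g ≤ h) :
    lowerIntegral ν g ≤ lowerIntegral ν h := by
  refine iSup_mono fun n => iSup_mono fun r => iSup_mono fun U => ?_
  exact iSup_le fun H => le_iSup_of_le (fun x => (H x).trans (hgh x)) le_rfl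

theorem le_lowerIntegral (ν : ContValuation X) {ι : Type*} (s : Finset ι) (r : ι → ℝ≥0∞)
    (U : ι → Opens X) (g : X → ℝ≥0∞) (h : ∀ x, ∑ i ∈ s, r i * ind (U i) x ≤ g x) :
    ∑ i ∈ s, r i * ν (U i) ≤ lowerIntegral ν g := by
  let e := s.equivFin.symm
  have key : ∀ f : ι → ℝ≥0∞, ∑ i, f (e i) = ∑ i ∈ s, f i := by
    intro f
    rw [← Finset.sum_coe_sort s f]
    exact Equiv.sum_comp e (fun i : s => f i)
  rw [← key]
  exact le_iSup_of_le s.card <| le_iSup_of_le (fun i => r (e i)) <|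
    le_iSup_of_le (fun i => U (e i)) <| le_iSup_of_le
      (fun x => (key fun i => r i * ind (U i) x).trans_le (h x)) le_rfl

end Basic

section Interp
variable {X : Type u} [TopologicalSpace X] {ι : Type*} [Fintype ι] [DecidableEq ι]

open Classical in
/-- The set of indices of the members of `U` containing `x`. -/
noncomputable def cell (U : ι → Opens X) (x : X) : Finset ι := Finset.univ.filter (fun i => x ∈ U i)

/-- The union over `t ∈ A` of the intersections of the `U i`, `i ∈ t`. -/
def layer (U : ι → Opens X) (A : Finset (Finset ι)) : Opens X := A.sup fun t => t.inf U

theorem mem_inf_iff (U : ι → Opens X) (t : Finset ι) (x : X) : x ∈ t.inf U ↔ t ⊆ cell U x := by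
  rw [← SetLike.mem_coe, Opens.coe_finset_inf]
  simp [cell, Finset.subset_iff]

theorem mem_layer_iff (U : ι → Opens X) {A : Finset (Finset ι)} (hA : IsUpperSet (A : Set (Finset ι)))
    (x : X) : x ∈ layer U A ↔ cell U x ∈ A := by
  rw [layer, ← SetLike.mem_coe, Opens.coe_finset_sup]
  simp only [Finset.sup_eq_iSup, Set.iSup_eq_iUnion, Set.mem_iUnion, Function.comp, SetLike.mem_coe,
    mem_inf_iff]
  constructor
  · rintro ⟨t, ht, h⟩
    exact hA h ht
  · intro h
    exact ⟨_, h, subset_rfl⟩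

/-- Weights of the cells that represent `ν` on the sets `U i` as a finite sum of point masses. -/
noncomputable def weight (ν : ContValuation X) (U : ι → Opens X) (t : Finset ι) : ℝ≥0∞ :=
  ν (t.inf U) - ν (layer U (Finset.univ.filter (fun s => t ⊂ s)))

theorem upper_ssubset (t : Finset ι) :
    IsUpperSet ((Finset.univ.filter (fun s => t ⊂ s) : Finset (Finset ι)) : Set (Finset ι)) := by
  intro a b hab ha
  simp only [Finset.coe_filter, Finset.mem_univ, true_and, Set.mem_ofPred_eq] at ha ⊢
  exact lt_of_lt_of_le ha hab

theorem val_layer (ν : ContValuation X) (U : ι → Opens X) (A : Finset (Finset ι))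
    (hA : IsUpperSet (A : Set (Finset ι))) : ν (layer U A) = ∑ t ∈ A, weight ν U t := by
  induction hn : A.card generalizing A with
  | zero =>
    rw [Finset.card_eq_zero] at hn
    subst hn
    simp [layer, ν.map_bot']
  | succ n ih =>
    have hne : A.Nonempty := by rw [← Finset.card_pos]; omega
    obtain ⟨t, ht⟩ := A.exists_minimal hne
    have hA' : IsUpperSet ((A.erase t : Finset _) : Set (Finset ι)) := by
      intro a b hab ha
      simp only [Finset.coe_erase, Set.mem_sdiff, Finset.mem_coe, Set.mem_singleton_iff] at ha ⊢
      refine ⟨hA hab ha.1, ?_⟩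
      rintro rfl
      exact ha.2 (le_antisymm hab (ht.2 ha.1 hab))
    have h1 := ih (A.erase t) hA' (by rw [Finset.card_erase_of_mem ht.1]; omega)
    have hup := upper_ssubset t
    have h2 : layer U A = layer U (A.erase t) ⊔ t.inf U := by
      conv_lhs => rw [← Finset.insert_erase ht.1]
      rw [layer, Finset.sup_insert, sup_comm]; rfl
    have h3 : layer U (A.erase t) ⊓ t.inf U = layer U (Finset.univ.filter (fun s => t ⊂ s)) := by
      ext x
      simp only [Opens.coe_inf, Set.mem_inter_iff, SetLike.mem_coe, mem_layer_iff U hA',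
        mem_layer_iff U hup, mem_inf_iff, Finset.mem_erase, Finset.mem_filter, Finset.mem_univ,
        true_and]
      constructor
      · rintro ⟨⟨h, -⟩, h'⟩
        exact lt_of_le_of_ne h' (Ne.symm h)
      · intro h
        exact ⟨⟨h.ne', hA h.le ht.1⟩, h.le⟩
    have hm := ν.modular' (layer U (A.erase t)) (t.inf U)
    rw [← h2, h3] at hm
    have hle : ν (layer U (Finset.univ.filter (fun s => t ⊂ s))) ≤ ν (t.inf U) :=
      ν.mono' (h3 ▸ inf_le_right)
    have hle' : ν (layer U (Finset.univ.filter (fun s => t ⊂ s))) ≤ ν (layer U A) :=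
      ν.mono' (h3 ▸ h2 ▸ inf_le_left.trans le_sup_left)
    have hle'' : ν (layer U (Finset.univ.filter (fun s => t ⊂ s))) ≤ ν (layer U (A.erase t)) :=
      ν.mono' (h3 ▸ inf_le_left)
    rw [← Finset.add_sum_erase A _ ht.1, ← h1]
    by_cases htop : ν (layer U (Finset.univ.filter (fun s => t ⊂ s))) = ⊤
    · rw [htop, top_le_iff] at hle' hle''
      rw [hle', hle'']; simp
    · have : ν (t.inf U) = weight ν U t + ν (layer U (Finset.univ.filter (fun s => t ⊂ s))) :=
        (tsub_add_cancel_of_le hle).symm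
      rw [this, ← add_assoc] at hm
      rw [(ENNReal.add_left_inj htop).1 hm, add_comm]

theorem weight_eq_zero (ν : ContValuation X) (U : ι → Opens X) (t : Finset ι)
    (h : ∀ x, cell U x ≠ t) : weight ν U t = 0 := by
  have : t.inf U = layer U (Finset.univ.filter (fun s => t ⊂ s)) := by
    ext x
    simp only [SetLike.mem_coe, mem_layer_iff U (upper_ssubset t), mem_inf_iff, Finset.mem_filter,
      Finset.mem_univ, true_and]
    exact ⟨fun h' => lt_of_le_of_ne h' (h x).symm, fun h' => h'.le⟩
  rw [weight, this, tsub_self]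

theorem sum_ind (U : ι → Opens X) (r : ι → ℝ≥0∞) (x : X) :
    ∑ i, r i * ind (U i) x = ∑ i ∈ cell U x, r i := by
  classical
  rw [cell, Finset.sum_filter]
  refine Finset.sum_congr rfl fun i _ => ?_
  by_cases h : x ∈ U i <;> simp [ind, h]

theorem val_level (ν : ContValuation X) (U : ι → Opens X) (P : Finset ι → Prop) [DecidablePred P]
    (hP : ∀ s t, s ⊆ t → P s → P t) (W : Opens X) (hW : ∀ x, x ∈ W ↔ P (cell U x)) :
    ν W = ∑ t, weight ν U t * (if P t then 1 else 0) := by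
  have hup : IsUpperSet ((Finset.univ.filter P : Finset (Finset ι)) : Set (Finset ι)) := by
    intro a b hab ha
    simp only [Finset.coe_filter, Finset.mem_univ, true_and, Set.mem_ofPred_eq] at ha ⊢
    exact hP _ _ hab ha
  have : W = layer U (Finset.univ.filter P) := by
    ext x
    simp [SetLike.mem_coe, mem_layer_iff U hup, hW]
  rw [this, val_layer ν U _ hup, Finset.sum_filter]
  simp

theorem sum_val (ν : ContValuation X) (U : ι → Opens X) (r : ι → ℝ≥0∞) :
    ∑ i, r i * ν (U i) = ∑ t, weight ν U t * ∑ i ∈ t, r i := by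
  have : ∀ i, ν (U i) = ∑ t, weight ν U t * (if i ∈ t then 1 else 0) := fun i =>
    val_level ν U (fun t => i ∈ t) (fun s t hst h => hst h) _ (fun x => by simp [cell])
  simp_rw [this, Finset.mul_sum]
  rw [Finset.sum_comm]
  refine Finset.sum_congr rfl fun t _ => ?_
  rw [← Finset.sum_filter_add_sum_filter_not Finset.univ (fun i => i ∈ t)]
  rw [Finset.sum_eq_zero (s := Finset.univ.filter (fun i => ¬ i ∈ t)), add_zero]
  · simp only [Finset.filter_univ_mem]
    exact Finset.sum_congr rfl fun i hi => by simp [hi, mul_comm]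
  · intro i hi
    simp [(Finset.mem_filter.1 hi).2]

end Interp

/-- The `n`-th dyadic lower approximation. -/
noncomputable def dyad (n : ℕ) (y : ℝ≥0∞) : ℝ≥0∞ :=
  ∑ k ∈ Finset.range (4 ^ n), (2 ^ n : ℝ≥0∞)⁻¹ * (if (k + 1 : ℝ≥0∞) * (2 ^ n)⁻¹ < y then 1 else 0)

theorem dyad_le (n : ℕ) (y : ℝ≥0∞) : dyad n y ≤ y := by
  have : ∀ N : ℕ, ∑ k ∈ Finset.range N,
      (2 ^ n : ℝ≥0∞)⁻¹ * (if (k + 1 : ℝ≥0∞) * (2 ^ n)⁻¹ < y then 1 else 0) ≤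
      min y (N * (2 ^ n)⁻¹) := by
    intro N
    induction N with
    | zero => simp
    | succ N ih =>
      rw [Finset.sum_range_succ]
      split_ifs with h
      · have h1 : ((N : ℝ≥0∞) * (2 ^ n)⁻¹ + (2 ^ n)⁻¹) = (N + 1) * (2 ^ n)⁻¹ := by ring
        push_cast
        rw [min_eq_right h.le, mul_one, ← h1]
        gcongr
        exact ih.trans (min_le_right _ _)
      · rw [mul_zero, add_zero]
        refine ih.trans ?_
        gcongr
        simp
  exact (this _).trans (min_le_left _ _)

theorem dyad_mono_right (n : ℕ) : Monotone (dyad n) := by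
  intro y z h
  refine Finset.sum_le_sum fun k _ => ?_
  gcongr
  split_ifs with h1 h2 <;> simp
  exact h2 (h1.trans_le h)

theorem sum_range_two_mul (f : ℕ → ℝ≥0∞) (M : ℕ) :
    ∑ k ∈ Finset.range (2 * M), f k = ∑ k ∈ Finset.range M, (f (2 * k) + f (2 * k + 1)) := by
  induction M with
  | zero => simp
  | succ M ih =>
    rw [show 2 * (M + 1) = 2 * M + 1 + 1 by ring, Finset.sum_range_succ, Finset.sum_range_succ, ih,
      Finset.sum_range_succ, add_assoc]

theorem half_pow (n : ℕ) : (2 ^ n : ℝ≥0∞)⁻¹ = 2 * (2 ^ (n + 1))⁻¹ := by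
  rw [pow_succ, ENNReal.mul_inv (by simp) (by simp), mul_comm, mul_assoc,
    ENNReal.inv_mul_cancel (by simp) (by simp), mul_one]

theorem dyad_mono_left (y : ℝ≥0∞) : Monotone (fun n => dyad n y) := by
  refine monotone_nat_of_le_succ fun n => ?_
  have hsub : Finset.range (2 * 4 ^ n) ⊆ Finset.range (4 ^ (n + 1)) := by
    apply Finset.range_mono
    rw [pow_succ]
    have := Nat.pow_pos (n := n) (show 0 < 4 by norm_num)
    omega
  refine le_trans ?_ (Finset.sum_le_sum_of_subset hsub)
  rw [sum_range_two_mul]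
  refine Finset.sum_le_sum fun k _ => ?_
  rw [half_pow]
  generalize (2 ^ (n + 1) : ℝ≥0∞)⁻¹ = q
  push_cast
  have e : ((k : ℝ≥0∞) + 1) * (2 * q) = (2 * k + 1 + 1) * q := by ring
  rw [e]
  by_cases h1 : (2 * (k : ℝ≥0∞) + 1 + 1) * q < y
  · have h2 : (2 * (k : ℝ≥0∞) + 1) * q < y := by
      refine lt_of_le_of_lt ?_ h1
      gcongr
      exact le_self_add
    rw [if_pos h1, if_pos h2, mul_one, mul_one, two_mul]
  · simp [h1]

theorem le_dyad (n m : ℕ) (y : ℝ≥0∞) (hm : m ≤ 4 ^ n) (h : (m : ℝ≥0∞) * (2 ^ n)⁻¹ < y) :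
    (m : ℝ≥0∞) * (2 ^ n)⁻¹ ≤ dyad n y := by
  refine le_trans ?_ (Finset.sum_le_sum_of_subset (Finset.range_mono hm))
  have : ∀ k ∈ Finset.range m,
      (2 ^ n : ℝ≥0∞)⁻¹ * (if (k + 1 : ℝ≥0∞) * (2 ^ n)⁻¹ < y then 1 else 0) = (2 ^ n)⁻¹ := by
    intro k hk
    rw [if_pos, mul_one]
    refine lt_of_le_of_lt ?_ h
    gcongr
    exact_mod_cast Finset.mem_range.1 hk
  rw [Finset.sum_congr rfl this]
  simp

theorem iSup_dyad (y : ℝ≥0∞) : ⨆ n, dyad n y = y := by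
  refine le_antisymm (iSup_le fun n => dyad_le n y) ?_
  refine le_of_forall_lt fun c hc => ?_
  obtain ⟨a, hca, hay⟩ := exists_between hc
  obtain ⟨b, hab, hby⟩ := exists_between hay
  lift b to ℝ≥0 using hby.ne_top
  lift a to ℝ≥0 using hab.ne_top
  refine lt_of_lt_of_le hca ?_
  have hab' : a < b := by exact_mod_cast hab
  obtain ⟨n₁, hn₁⟩ := pow_unbounded_of_one_lt (a + 1 : ℝ) (one_lt_two)
  obtain ⟨n₂, hn₂⟩ := exists_pow_lt_of_lt_one (sub_pos.2 (show (a : ℝ) < b from hab'))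
    (show (1 / 2 : ℝ) < 1 by norm_num)
  let n := max n₁ n₂
  have hn1 : (a + 1 : ℝ) ≤ 2 ^ n := hn₁.le.trans (pow_le_pow_right₀ one_le_two (le_max_left _ _))
  have hn2 : ((2 : ℝ) ^ n)⁻¹ < b - a := by
    refine lt_of_le_of_lt ?_ hn₂
    rw [← inv_pow, ← one_div]
    exact pow_le_pow_of_le_one (by norm_num) (by norm_num) (le_max_right _ _)
  have hpos : (0 : ℝ) < 2 ^ n := by positivity
  let m := ⌈(a : ℝ) * 2 ^ n⌉₊
  have hm1 : (a : ℝ) * 2 ^ n ≤ m := Nat.le_ceil _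
  have hm2 : (m : ℝ) < a * 2 ^ n + 1 := Nat.ceil_lt_add_one (by positivity)
  have hm4 : m ≤ 4 ^ n := by
    have : (m : ℝ) ≤ 4 ^ n := by
      have h4 : (4 : ℝ) ^ n = 2 ^ n * 2 ^ n := by rw [← mul_pow]; norm_num
      have h1 : (1 : ℝ) ≤ 2 ^ n := one_le_pow₀ one_le_two
      rw [h4]; nlinarith
    exact_mod_cast this
  have hconv : (m : ℝ≥0∞) * (2 ^ n)⁻¹ = ((m * (2 ^ n)⁻¹ : ℝ≥0) : ℝ≥0∞) := by
    rw [ENNReal.coe_mul, ENNReal.coe_inv (by positivity)]; simp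
  have hmb : (m : ℝ≥0∞) * (2 ^ n)⁻¹ < y := by
    refine lt_trans ?_ hby
    rw [hconv, ENNReal.coe_lt_coe, ← NNReal.coe_lt_coe]
    push_cast
    rw [← div_eq_mul_inv, div_lt_iff₀ hpos]
    have : 1 < (b - a : ℝ) * 2 ^ n := by
      rwa [← inv_lt_iff_one_lt_mul₀ hpos]
    nlinarith
  refine le_iSup_of_le n (le_trans ?_ (le_dyad n m y hm4 hmb))
  rw [hconv, ENNReal.coe_le_coe, ← NNReal.coe_le_coe]
  push_cast
  rwa [← div_eq_mul_inv, le_div_iff₀ hpos]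


section Integral
variable {X : Type u} [TopologicalSpace X]

/-- The open set where `g` exceeds `c` (for lower semicontinuous `g`). -/
def lev (g : X → ℝ≥0∞) (c : ℝ≥0∞) : Opens X := Opens.interior {x | c < g x}

theorem mem_lev {g : X → ℝ≥0∞} (hg : LowerSemicontinuous g) (c : ℝ≥0∞) (x : X) :
    x ∈ lev g c ↔ c < g x := by
  have : IsOpen {x | c < g x} := hg.isOpen_preimage c
  rw [← SetLike.mem_coe, lev, Opens.coe_interior, this.interior_eq]
  rfl

/-- The integral of the `n`-th dyadic approximation of `g`. -/
noncomputable def dyadInt (ν : ContValuation X) (n : ℕ) (g : X → ℝ≥0∞) : ℝ≥0∞ :=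
  ∑ k ∈ Finset.range (4 ^ n), (2 ^ n : ℝ≥0∞)⁻¹ * ν (lev g ((k + 1) * (2 ^ n)⁻¹))

theorem ind_lsc (U : Opens X) : LowerSemicontinuous (ind U) :=
  U.isOpen.lowerSemicontinuous_indicator zero_le_one

theorem sum_lsc {ι : Type*} (s : Finset ι) (r : ι → ℝ≥0∞) (U : ι → Opens X) :
    LowerSemicontinuous (fun x => ∑ i ∈ s, r i * ind (U i) x) := by
  refine lowerSemicontinuous_sum fun i _ => ?_
  rw [lowerSemicontinuous_iff_isOpen_preimage]
  intro y
  have : (fun x => r i * ind (U i) x) ⁻¹' Set.Ioi y = if y < r i then (U i : Set X) else ∅ := by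
    ext x
    by_cases hx : x ∈ U i <;> by_cases hy : y < r i <;> simp [ind, hx, hy]
  rw [this]
  split_ifs
  exacts [(U i).isOpen, isOpen_empty]

theorem dyadInt_le (ν : ContValuation X) (n : ℕ) (g : X → ℝ≥0∞) :
    dyadInt ν n g ≤ lowerIntegral ν g := by
  refine le_lowerIntegral ν _ _ _ _ fun x => le_trans ?_ (dyad_le n (g x))
  refine Finset.sum_le_sum fun k _ => ?_
  gcongr
  by_cases h : x ∈ lev g ((k + 1) * (2 ^ n)⁻¹)
  · have : (k + 1 : ℝ≥0∞) * (2 ^ n)⁻¹ < g x :=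
      interior_subset (s := {x | (k + 1 : ℝ≥0∞) * (2 ^ n)⁻¹ < g x}) h
    rw [if_pos this]
    exact Set.indicator_le_self' (by simp) _
  · simp [ind, h]

theorem dyadInt_mono (ν : ContValuation X) (n : ℕ) {g h : X → ℝ≥0∞} (hgh : g ≤ h) :
    dyadInt ν n g ≤ dyadInt ν n h := by
  refine Finset.sum_le_sum fun k _ => ?_
  gcongr
  exact ν.mono' (interior_mono fun x hx => lt_of_lt_of_le hx (hgh x))

theorem dyadInt_simple (ν : ContValuation X) (n : ℕ) {ι : Type*} [Fintype ι] [DecidableEq ι]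
    (r : ι → ℝ≥0∞) (U : ι → Opens X) :
    dyadInt ν n (fun x => ∑ i, r i * ind (U i) x) =
      ∑ t, weight ν U t * dyad n (∑ i ∈ t, r i) := by
  have hl := sum_lsc Finset.univ r U
  simp_rw [dyadInt, dyad, Finset.mul_sum]
  rw [Finset.sum_comm]
  refine Finset.sum_congr rfl fun k _ => ?_
  rw [val_level ν U (fun t => (k + 1 : ℝ≥0∞) * (2 ^ n)⁻¹ < ∑ i ∈ t, r i)
    (fun s t hst h => h.trans_le (Finset.sum_le_sum_of_subset hst)) _
    (fun x => by rw [mem_lev hl, sum_ind]), Finset.mul_sum]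
  exact Finset.sum_congr rfl fun t _ => by ring

theorem iSup_dyadInt_simple (ν : ContValuation X) {ι : Type*} [Fintype ι] [DecidableEq ι]
    (r : ι → ℝ≥0∞) (U : ι → Opens X) :
    ⨆ n, dyadInt ν n (fun x => ∑ i, r i * ind (U i) x) = ∑ i, r i * ν (U i) := by
  simp_rw [dyadInt_simple]
  rw [← ENNReal.finsetSum_iSup_of_monotone, sum_val]
  · refine Finset.sum_congr rfl fun t _ => ?_
    rw [← ENNReal.mul_iSup, iSup_dyad]
  · intro t a b hab
    exact mul_le_mul_right (dyad_mono_left _ hab) _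

theorem lowerIntegral_le (ν : ContValuation X) (g : X → ℝ≥0∞) :
    lowerIntegral ν g ≤ ⨆ n, dyadInt ν n g := by
  refine iSup_le fun n => iSup_le fun r => iSup_le fun U => iSup_le fun H => ?_
  rw [← iSup_dyadInt_simple]
  exact iSup_mono fun n => dyadInt_mono ν n H

/-- The integral is the supremum of the dyadic sums. -/
theorem lowerIntegral_eq (ν : ContValuation X) (g : X → ℝ≥0∞) :
    lowerIntegral ν g = ⨆ n, dyadInt ν n g :=
  le_antisymm (lowerIntegral_le ν g) (iSup_le fun n => dyadInt_le ν n g)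

/-- The integral of a simple function is given by any of its representations. -/
theorem lowerIntegral_simple (ν : ContValuation X) {ι : Type*} (s : Finset ι)
    (r : ι → ℝ≥0∞) (U : ι → Opens X) :
    lowerIntegral ν (fun x => ∑ i ∈ s, r i * ind (U i) x) = ∑ i ∈ s, r i * ν (U i) := by
  classical
  have := iSup_dyadInt_simple ν (fun i : s => r i) (fun i : s => U i)
  rw [← lowerIntegral_eq] at this
  rw [← Finset.sum_coe_sort s (fun i => r i * ν (U i)), ← this]
  congr 1
  funext x
  exact (Finset.sum_coe_sort s (fun i => r i * ind (U i) x)).symm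

theorem lowerIntegral_iSup (ν : ContValuation X) {ι : Type*} [Nonempty ι] (g : ι → X → ℝ≥0∞)
    (hg : ∀ i, LowerSemicontinuous (g i)) (hd : Directed (· ≤ ·) g) :
    lowerIntegral ν (fun x => ⨆ i, g i x) = ⨆ i, lowerIntegral ν (g i) := by
  simp_rw [lowerIntegral_eq]
  rw [iSup_comm]
  refine iSup_congr fun n => ?_
  have hmono : ∀ (c : ℝ≥0∞) {a b : ι}, g a ≤ g b → lev (g a) c ≤ lev (g b) c := fun c a b hab =>
    interior_mono fun x hx => lt_of_lt_of_le hx (hab x)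
  have hsup : LowerSemicontinuous (fun x => ⨆ i, g i x) := lowerSemicontinuous_iSup hg
  have key : ∀ c, ν (lev (fun x => ⨆ i, g i x) c) = ⨆ i, ν (lev (g i) c) := by
    intro c
    rw [← ν.scott_iSup]
    · congr 1
      ext x
      simp [SetLike.mem_coe, mem_lev hsup, mem_lev (hg _), lt_iSup_iff]
    · intro i j
      obtain ⟨k, hik, hjk⟩ := hd i j
      exact ⟨k, hmono c hik, hmono c hjk⟩
  simp_rw [dyadInt, key, ENNReal.mul_iSup]
  rw [ENNReal.finsetSum_iSup]
  intro i j
  obtain ⟨k, hik, hjk⟩ := hd i j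
  exact ⟨k, fun a => ⟨mul_le_mul_right (ν.mono' (hmono _ hik)) _,
    mul_le_mul_right (ν.mono' (hmono _ hjk)) _⟩⟩

/-- The dyadic approximation of `g` as a simple function. -/
noncomputable def dyadFun (n : ℕ) (g : X → ℝ≥0∞) (x : X) : ℝ≥0∞ :=
  ∑ k ∈ Finset.range (4 ^ n), (2 ^ n : ℝ≥0∞)⁻¹ * ind (lev g ((k + 1) * (2 ^ n)⁻¹)) x

theorem dyadFun_eq (n : ℕ) {g : X → ℝ≥0∞} (hg : LowerSemicontinuous g) (x : X) :
    dyadFun n g x = dyad n (g x) := by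
  refine Finset.sum_congr rfl fun k _ => ?_
  by_cases h : (k + 1 : ℝ≥0∞) * (2 ^ n)⁻¹ < g x
  · simp [ind, (mem_lev hg _ x).2 h, h]
  · simp [ind, (mem_lev hg _ x).not.2 h, h]

theorem dyadFun_lsc (n : ℕ) (g : X → ℝ≥0∞) : LowerSemicontinuous (dyadFun n g) := sum_lsc _ _ _

theorem iSup_dyadFun {g : X → ℝ≥0∞} (hg : LowerSemicontinuous g) (x : X) :
    ⨆ n, dyadFun n g x = g x := by
  simp_rw [dyadFun_eq _ hg, iSup_dyad]

theorem dyadFun_mono {g : X → ℝ≥0∞} (hg : LowerSemicontinuous g) :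
    Monotone (fun n => dyadFun n g) := by
  intro a b hab x
  simp only [dyadFun_eq _ hg]
  exact dyad_mono_left _ hab

theorem lowerIntegral_add (ν : ContValuation X) {g h : X → ℝ≥0∞} (hg : LowerSemicontinuous g)
    (hh : LowerSemicontinuous h) :
    lowerIntegral ν (fun x => g x + h x) = lowerIntegral ν g + lowerIntegral ν h := by
  have h1 : (fun x => g x + h x) = fun x => ⨆ n, (dyadFun n g x + dyadFun n h x) := by
    funext x
    rw [← ENNReal.iSup_add_iSup_of_monotone (fun a b hab => dyadFun_mono hg hab x)
      (fun a b hab => dyadFun_mono hh hab x), iSup_dyadFun hg, iSup_dyadFun hh]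
  have hm : Monotone (fun n x => dyadFun n g x + dyadFun n h x) := fun a b hab x =>
    add_le_add (dyadFun_mono hg hab x) (dyadFun_mono hh hab x)
  have hsimp : ∀ n, lowerIntegral ν (fun x => dyadFun n g x + dyadFun n h x) =
      lowerIntegral ν (dyadFun n g) + lowerIntegral ν (dyadFun n h) := by
    intro n
    have e1 := lowerIntegral_simple ν (Finset.range (4 ^ n)) (fun _ => (2 ^ n : ℝ≥0∞)⁻¹)
      (fun k => lev g ((k + 1) * (2 ^ n)⁻¹))
    have e2 := lowerIntegral_simple ν (Finset.range (4 ^ n)) (fun _ => (2 ^ n : ℝ≥0∞)⁻¹)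
      (fun k => lev h ((k + 1) * (2 ^ n)⁻¹))
    have e3 := lowerIntegral_simple ν ((Finset.range (4 ^ n)).disjSum (Finset.range (4 ^ n)))
      (fun _ => (2 ^ n : ℝ≥0∞)⁻¹)
      (Sum.elim (fun k => lev g ((k + 1) * (2 ^ n)⁻¹)) (fun k => lev h ((k + 1) * (2 ^ n)⁻¹)))
    simp only [Finset.sum_disjSum, Sum.elim_inl, Sum.elim_inr] at e3
    exact e3.trans (congrArg₂ (· + ·) e1.symm e2.symm)
  have hc : ∀ {g : X → ℝ≥0∞}, LowerSemicontinuous g →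
      lowerIntegral ν g = ⨆ n, lowerIntegral ν (dyadFun n g) := by
    intro g hg
    rw [← lowerIntegral_iSup ν _ (fun n => dyadFun_lsc n g) (dyadFun_mono hg).directed_le]
    simp_rw [iSup_dyadFun hg]
  rw [h1, lowerIntegral_iSup ν _ (fun n => (dyadFun_lsc n g).add (dyadFun_lsc n h)) hm.directed_le,
    hc hg, hc hh, ENNReal.iSup_add_iSup_of_monotone
      (fun a b hab => lowerIntegral_mono ν (dyadFun_mono hg hab))
      (fun a b hab => lowerIntegral_mono ν (dyadFun_mono hh hab))]
  exact iSup_congr hsimp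

theorem lowerIntegral_zero (ν : ContValuation X) : lowerIntegral ν (fun _ => 0) = 0 := by
  have := lowerIntegral_simple ν (∅ : Finset ℕ) (fun _ => 0) (fun _ => ⊥)
  simpa using this

theorem lowerIntegral_ind (ν : ContValuation X) (U : Opens X) :
    lowerIntegral ν (ind U) = ν U := by
  have := lowerIntegral_simple ν {()} (fun _ => 1) (fun _ => U)
  simpa using this


theorem mul_eq_iSup (c : ℝ≥0∞) {g : X → ℝ≥0∞} (hg : LowerSemicontinuous g) :
    (fun x => c * g x) = fun x => ⨆ n, ∑ k ∈ Finset.range (4 ^ n), (c * (2 ^ n : ℝ≥0∞)⁻¹) *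
      ind (lev g ((k + 1) * (2 ^ n)⁻¹)) x := by
  funext x
  rw [← iSup_dyadFun hg, ENNReal.mul_iSup]
  simp_rw [dyadFun, Finset.mul_sum, mul_assoc]

theorem mul_lsc (c : ℝ≥0∞) {g : X → ℝ≥0∞} (hg : LowerSemicontinuous g) :
    LowerSemicontinuous (fun x => c * g x) := by
  rw [mul_eq_iSup c hg]
  exact lowerSemicontinuous_iSup fun n => sum_lsc _ _ _

theorem lowerIntegral_mul (ν : ContValuation X) (c : ℝ≥0∞) {g : X → ℝ≥0∞}
    (hg : LowerSemicontinuous g) :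
    lowerIntegral ν (fun x => c * g x) = c * lowerIntegral ν g := by
  rw [mul_eq_iSup c hg, lowerIntegral_iSup ν _ (fun n => sum_lsc _ _ _), lowerIntegral_eq ν g,
    ENNReal.mul_iSup]
  · refine iSup_congr fun n => ?_
    rw [lowerIntegral_simple, dyadInt, Finset.mul_sum]
    exact Finset.sum_congr rfl fun k _ => mul_assoc _ _ _
  · refine Monotone.directed_le fun a b hab x => ?_
    have := mul_le_mul_right (dyadFun_mono hg hab x) c
    simpa only [dyadFun, Finset.mul_sum, mul_assoc] using this

theorem lowerIntegral_sum (ν : ContValuation X) {ι : Type*} (s : Finset ι) (g : ι → X → ℝ≥0∞)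
    (hg : ∀ i, LowerSemicontinuous (g i)) :
    lowerIntegral ν (fun x => ∑ i ∈ s, g i x) = ∑ i ∈ s, lowerIntegral ν (g i) := by
  classical
  induction s using Finset.induction_on with
  | empty => simpa using lowerIntegral_zero ν
  | insert a s ha ih =>
    simp_rw [Finset.sum_insert ha]
    rw [lowerIntegral_add ν (hg a) (lowerSemicontinuous_sum fun i _ => hg i), ih]

theorem lowerIntegral_lsc (g : X → ℝ≥0∞) :
    LowerSemicontinuous (fun ν : ContValuation X => lowerIntegral ν g) := by
  refine lowerSemicontinuous_iSup fun n => lowerSemicontinuous_iSup fun r =>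
    lowerSemicontinuous_iSup fun U => lowerSemicontinuous_iSup fun _ =>
    lowerSemicontinuous_sum fun i _ => mul_lsc _ (lsc_eval _)

end Integral

section Operations
variable {X Y : Type u} [TopologicalSpace X] [TopologicalSpace Y]

/-- The pushforward of a valuation: `f_* ν (U) = ν (f⁻¹ U)`. -/
def map (f : C(X, Y)) (ν : ContValuation X) : ContValuation Y where
  toFun U := ν (U.comap f)
  map_bot' := by
    have : (⊥ : Opens Y).comap f = ⊥ := by ext; simp
    rw [this, ν.map_bot']
  mono' U V h := ν.mono' (Opens.comap_mono f h)
  modular' U V := ν.modular' (U.comap f) (V.comap f)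
  scott' D hD hdir := by
    have : Nonempty D := hD.to_subtype
    have e : (sSup D).comap f = ⨆ U : D, (U : Opens Y).comap f := by
      ext x; simp [sSup_eq_iSup']
    rw [e, ν.scott_iSup, iSup_subtype']
    intro U V
    obtain ⟨W, hW, h1, h2⟩ := hdir U U.2 V V.2
    exact ⟨⟨W, hW⟩, Opens.comap_mono f h1, Opens.comap_mono f h2⟩

theorem map_apply (f : C(X, Y)) (ν : ContValuation X) (U : Opens Y) :
    map f ν U = ν (U.comap f) := rfl

theorem continuous_map (f : C(X, Y)) : Continuous (map f) :=
  continuous_iff_lsc.2 fun U => lsc_eval (U.comap f)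

/-- The Dirac valuation at `x`: it takes the value `1` at open neighbourhoods of `x`, and `0` at
the other open sets. -/
noncomputable def dirac (x : X) : ContValuation X where
  toFun U := ind U x
  map_bot' := by simp [ind]
  mono' U V h := Set.indicator_le_indicator_of_subset h (by simp) x
  modular' U V := by
    by_cases hU : x ∈ U <;> by_cases hV : x ∈ V <;> simp [ind, hU, hV]
  scott' D _ _ := by
    by_cases h : ∃ U ∈ D, x ∈ U
    · obtain ⟨U, hU, hx⟩ := h
      have h1 : ind U x = 1 := by simp [ind, hx]
      refine le_antisymm (le_iSup₂_of_le U hU ?_) (iSup₂_le fun V hV => ?_)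
      · rw [h1]
        exact Set.indicator_le_self' (by simp) x
      · exact Set.indicator_le_indicator_of_subset (le_sSup hV : V ≤ sSup D) (by simp) x
    · push Not at h
      have hx : x ∉ sSup D := by
        rw [Opens.mem_sSup]
        rintro ⟨U, hU, hxU⟩
        exact h U hU hxU
      have h1 : ind (sSup D) x = 0 := Set.indicator_of_notMem hx _
      rw [h1]
      exact bot_le.antisymm (iSup₂_le fun V hV => by simp [ind, h V hV])

theorem continuous_dirac : Continuous (dirac : X → ContValuation X) :=
  continuous_iff_lsc.2 fun U => ind_lsc U

/-- The averaged valuation: `join ξ (U)` is the integral of `ν ↦ ν (U)` with respect to `ξ`. -/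
noncomputable def join (ξ : ContValuation (ContValuation X)) : ContValuation X where
  toFun U := lowerIntegral ξ (fun ν => ν U)
  map_bot' := by simp_rw [map_bot']; exact lowerIntegral_zero ξ
  mono' U V h := lowerIntegral_mono ξ fun ν => ν.mono' h
  modular' U V := by
    rw [← lowerIntegral_add ξ (lsc_eval _) (lsc_eval _), ← lowerIntegral_add ξ (lsc_eval _) (lsc_eval _)]
    simp_rw [modular']
  scott' D hD hdir := by
    have : Nonempty D := hD.to_subtype
    have hdir' : Directed (· ≤ ·) ((↑) : D → Opens X) := by
      intro U V
      obtain ⟨W, hW, h1, h2⟩ := hdir U U.2 V V.2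
      exact ⟨⟨W, hW⟩, h1, h2⟩
    rw [sSup_eq_iSup', iSup_subtype']
    simp_rw [scott_iSup _ _ hdir']
    rw [lowerIntegral_iSup ξ _ (fun U => lsc_eval _)]
    intro U V
    obtain ⟨W, h1, h2⟩ := hdir' U V
    exact ⟨W, fun ν => ν.mono' h1, fun ν => ν.mono' h2⟩

theorem join_apply (ξ : ContValuation (ContValuation X)) (U : Opens X) :
    join ξ U = lowerIntegral ξ (fun ν => ν U) := rfl

theorem continuous_join : Continuous (join : ContValuation (ContValuation X) → ContValuation X) :=
  continuous_iff_lsc.2 fun _ => lowerIntegral_lsc _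

theorem lowerIntegral_map (f : C(X, Y)) (ν : ContValuation X) {g : Y → ℝ≥0∞}
    (hg : LowerSemicontinuous g) : lowerIntegral (map f ν) g = lowerIntegral ν (fun x => g (f x)) := by
  simp_rw [lowerIntegral_eq]
  refine iSup_congr fun n => Finset.sum_congr rfl fun k _ => ?_
  congr 1
  rw [map_apply]
  congr 1
  ext x
  have hgf : LowerSemicontinuous (fun x => g (f x)) := hg.comp f.continuous
  simp [SetLike.mem_coe, mem_lev hg, mem_lev hgf]

theorem lowerIntegral_dirac (x : X) {g : X → ℝ≥0∞} (hg : LowerSemicontinuous g) :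
    lowerIntegral (dirac x) g = g x := by
  rw [lowerIntegral_eq, ← iSup_dyadFun hg]
  rfl

theorem lowerIntegral_join (ξ : ContValuation (ContValuation X)) {g : X → ℝ≥0∞}
    (hg : LowerSemicontinuous g) :
    lowerIntegral (join ξ) g = lowerIntegral ξ (fun ν => lowerIntegral ν g) := by
  have hd : ∀ (ν : ContValuation X) (n : ℕ), dyadInt ν n g = lowerIntegral ν (dyadFun n g) :=
    fun ν n => (lowerIntegral_simple ν _ _ _).symm
  have hl : ∀ n, LowerSemicontinuous (fun ν : ContValuation X => dyadInt ν n g) := fun n =>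
    lowerSemicontinuous_sum fun k _ => mul_lsc _ (lsc_eval _)
  simp_rw [lowerIntegral_eq _ g]
  rw [lowerIntegral_iSup ξ _ hl]
  · refine iSup_congr fun n => ?_
    simp_rw [dyadInt]
    rw [lowerIntegral_sum ξ _ _ (fun k => mul_lsc _ (lsc_eval _))]
    refine Finset.sum_congr rfl fun k _ => ?_
    rw [lowerIntegral_mul ξ _ (lsc_eval _), join_apply]
  · refine Monotone.directed_le fun a b hab ν => ?_
    simp only [hd]
    exact lowerIntegral_mono ν (dyadFun_mono hg hab)

/-- The inclusion of the slice `{x} × Y`. -/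
def slice (x : X) : C(Y, X × Y) := ⟨fun y => (x, y), by fun_prop⟩

/-- The strength `(x, ν) ↦ (j_x)_* ν`, where `j_x y = (x, y)`. -/
def strength (p : X × ContValuation Y) : ContValuation (X × Y) := map (slice p.1) p.2

theorem continuous_strength :
    Continuous (strength : X × ContValuation Y → ContValuation (X × Y)) := by
  refine continuous_iff_lsc.2 fun W => ?_
  rintro ⟨x, ν⟩ c hc
  change c < ν (W.comap (slice x)) at hc
  let T : Set (Opens X × Opens Y) := {q | x ∈ q.1 ∧ ∀ a ∈ q.1, ∀ b ∈ q.2, (a, b) ∈ W}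
  have hT0 : ((⊤, ⊥) : Opens X × Opens Y) ∈ T := ⟨trivial, fun a _ b hb => (hb : False).elim⟩
  have : Nonempty T := ⟨⟨_, hT0⟩⟩
  have hW : W.comap (slice x) = ⨆ q : T, (q : Opens X × Opens Y).2 := by
    ext y
    simp only [Opens.coe_comap, Set.mem_preimage, SetLike.mem_coe, Opens.mem_iSup]
    constructor
    · intro h
      obtain ⟨U, V, hU, hV, hx, hy, hUV⟩ := isOpen_prod_iff.1 W.isOpen x y h
      exact ⟨⟨(⟨U, hU⟩, ⟨V, hV⟩), hx, fun a ha b hb => hUV ⟨ha, hb⟩⟩, hy⟩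
    · rintro ⟨q, hq⟩
      exact q.2.2 x q.2.1 y hq
  have hdir : Directed (· ≤ ·) (fun q : T => (q : Opens X × Opens Y).2) := by
    rintro ⟨q, hq⟩ ⟨q', hq'⟩
    refine ⟨⟨(q.1 ⊓ q'.1, q.2 ⊔ q'.2), ⟨hq.1, hq'.1⟩, ?_⟩, le_sup_left, le_sup_right⟩
    rintro a ⟨ha, ha'⟩ b (hb | hb)
    · exact hq.2 a ha b hb
    · exact hq'.2 a ha' b hb
  rw [hW, ν.scott_iSup _ hdir, lt_iSup_iff] at hc
  obtain ⟨⟨q, hq⟩, hc⟩ := hc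
  have h1 : ∀ᶠ p : X × ContValuation Y in nhds (x, ν), p.1 ∈ q.1 :=
    (continuous_fst.tendsto (x, ν)).eventually (q.1.isOpen.mem_nhds hq.1)
  have h2 : ∀ᶠ p : X × ContValuation Y in nhds (x, ν), c < p.2 q.2 :=
    (continuous_snd.tendsto (x, ν)).eventually (lsc_eval q.2 ν c hc)
  filter_upwards [h1, h2] with p hp1 hp2
  exact hp2.trans_le (p.2.mono' fun b hb => hq.2 _ hp1 b hb)

end Operations

section Bundled
variable (X Y : Type u) [TopologicalSpace X] [TopologicalSpace Y]

/-- `f_*` as a continuous map. -/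
def mapC {X Y : Type u} [TopologicalSpace X] [TopologicalSpace Y] (f : C(X, Y)) :
    C(ContValuation X, ContValuation Y) := ⟨map f, continuous_map f⟩

/-- The Dirac map as a continuous map. -/
noncomputable def diracC : C(X, ContValuation X) := ⟨dirac, continuous_dirac⟩

/-- Averaging as a continuous map. -/
noncomputable def joinC : C(ContValuation (ContValuation X), ContValuation X) :=
  ⟨join, continuous_join⟩

/-- The strength as a continuous map. -/
def strengthC : C(X × ContValuation Y, ContValuation (X × Y)) :=
  ⟨strength, continuous_strength⟩

variable {X Y}

theorem join_map_map (f : C(X, Y)) (ξ : ContValuation (ContValuation X)) :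
    join (map (mapC f) ξ) = map f (join ξ) :=
  ext fun U => lowerIntegral_map (mapC f) ξ (lsc_eval U)

theorem join_map_join (Ξ : ContValuation (ContValuation (ContValuation X))) :
    join (map (joinC X) Ξ) = join (join Ξ) :=
  ext fun U => (lowerIntegral_map (joinC X) Ξ (lsc_eval U)).trans
    (lowerIntegral_join Ξ (lsc_eval U)).symm

theorem join_dirac (ν : ContValuation X) : join (dirac ν) = ν :=
  ext fun U => lowerIntegral_dirac ν (lsc_eval U)

theorem join_map_dirac (ν : ContValuation X) : join (map (diracC X) ν) = ν :=
  ext fun U => (lowerIntegral_map (diracC X) ν (lsc_eval U)).trans (lowerIntegral_ind ν U)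

theorem join_map_strength (x : X) (ξ : ContValuation (ContValuation Y)) :
    join (map (strengthC X Y) (strength (x, ξ))) = strength (x, join ξ) :=
  ext fun W => (lowerIntegral_map (strengthC X Y) _ (lsc_eval W)).trans
    (lowerIntegral_map (slice x) ξ ((lsc_eval W).comp (strengthC X Y).continuous))

end Bundled

end ContValuation

/-- The hyperspace of `X`: the closed subsets of `X`, including the empty one. -/
def Hyperspace (X : Type u) [TopologicalSpace X] : Type u := Closeds X

namespace Hyperspace

section Basic
variable {X Y : Type u} [TopologicalSpace X] [TopologicalSpace Y]

instance : SetLike (Hyperspace X) X := inferInstanceAs (SetLike (Closeds X) X)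

/-- The closed sets that hit `U`. -/
def hit (U : Opens X) : Set (Hyperspace X) := {C | ((C : Set X) ∩ U).Nonempty}

/-- The lower Vietoris topology. -/
instance : TopologicalSpace (Hyperspace X) := .generateFrom (Set.range hit)

theorem isOpen_hit (U : Opens X) : IsOpen (hit U) := isOpen_generateFrom_of_mem ⟨U, rfl⟩

/-- `hit U` as an open set of the hyperspace. -/
def hitOpen (U : Opens X) : Opens (Hyperspace X) := ⟨hit U, isOpen_hit U⟩

theorem continuous_iff_hit {Z : Type*} [TopologicalSpace Z] {F : Z → Hyperspace X} :
    Continuous F ↔ ∀ U : Opens X, IsOpen (F ⁻¹' hit U) := by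
  rw [continuous_generateFrom_iff]
  simp

theorem isClosed (C : Hyperspace X) : IsClosed (C : Set X) := Closeds.isClosed (α := X) C

/-- A closed set is determined by the open sets that it hits. -/
theorem ext_hit {C D : Hyperspace X} (h : ∀ U, C ∈ hit U ↔ D ∈ hit U) : C = D := by
  have key : ∀ {C D : Hyperspace X}, (∀ U, C ∈ hit U → D ∈ hit U) → (C : Set X) ⊆ D := by
    intro C D h x hx
    by_contra hD
    obtain ⟨y, hy, hy'⟩ := h ⟨(D : Set X)ᶜ, D.isClosed.isOpen_compl⟩ ⟨x, hx, hD⟩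
    exact hy' hy
  exact SetLike.coe_injective
    (Set.Subset.antisymm (key fun U => (h U).1) (key fun U => (h U).2))

/-- The closure of a set, as a point of the hyperspace. -/
def cl (A : Set X) : Hyperspace X := Closeds.closure A

theorem coe_cl (A : Set X) : (cl A : Set X) = closure A := rfl

theorem cl_mem_hit (A : Set X) (U : Opens X) : cl A ∈ hit U ↔ (A ∩ U).Nonempty :=
  closure_inter_open_nonempty_iff U.isOpen

/-- The map `f_♯` which sends `C` to the closure of `f '' C`. -/
def map (f : C(X, Y)) (C : Hyperspace X) : Hyperspace Y := cl (f '' (C : Set X))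

theorem map_mem_hit (f : C(X, Y)) (C : Hyperspace X) (U : Opens Y) :
    map f C ∈ hit U ↔ C ∈ hit (U.comap f) := by
  rw [map, cl_mem_hit]
  constructor
  · rintro ⟨_, ⟨x, hx, rfl⟩, hU⟩
    exact ⟨x, hx, hU⟩
  · rintro ⟨x, hx, hU⟩
    exact ⟨f x, ⟨x, hx, rfl⟩, hU⟩

theorem continuous_map (f : C(X, Y)) : Continuous (map f) := by
  refine continuous_iff_hit.2 fun U => ?_
  have : map f ⁻¹' hit U = hit (U.comap f) := Set.ext fun C => map_mem_hit f C U
  rw [this]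
  exact isOpen_hit _

/-- The closure of a point. -/
def point (x : X) : Hyperspace X := cl {x}

theorem point_mem_hit (x : X) (U : Opens X) : point x ∈ hit U ↔ x ∈ U := by
  simp [point, cl_mem_hit]

theorem continuous_point : Continuous (point : X → Hyperspace X) := by
  refine continuous_iff_hit.2 fun U => ?_
  have : point ⁻¹' hit U = (U : Set X) := Set.ext fun x => point_mem_hit x U
  rw [this]
  exact U.isOpen

/-- The closure of the union of a closed set of closed sets. -/
def union (K : Hyperspace (Hyperspace X)) : Hyperspace X := cl (⋃ C ∈ K, (C : Set X))

theorem union_mem_hit (K : Hyperspace (Hyperspace X)) (U : Opens X) :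
    union K ∈ hit U ↔ K ∈ hit (hitOpen U) := by
  rw [union, cl_mem_hit]
  constructor
  · rintro ⟨x, hx, hU⟩
    obtain ⟨C, hC, hx⟩ := Set.mem_iUnion₂.1 hx
    exact ⟨C, hC, x, hx, hU⟩
  · rintro ⟨C, hC, x, hx, hU⟩
    exact ⟨x, Set.mem_iUnion₂.2 ⟨C, hC, hx⟩, hU⟩

theorem continuous_union :
    Continuous (union : Hyperspace (Hyperspace X) → Hyperspace X) := by
  refine continuous_iff_hit.2 fun U => ?_
  have : union ⁻¹' hit U = hit (hitOpen U) := Set.ext fun K => union_mem_hit K U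
  rw [this]
  exact isOpen_hit _

/-- The strength `(x, C) ↦ (j_x)_♯ C`, where `j_x y = (x, y)`. -/
def strength (p : X × Hyperspace Y) : Hyperspace (X × Y) := map (ContValuation.slice p.1) p.2

theorem strength_mem_hit (p : X × Hyperspace Y) (W : Opens (X × Y)) :
    strength p ∈ hit W ↔ p.2 ∈ hit (W.comap (ContValuation.slice p.1)) := map_mem_hit _ _ _

theorem continuous_strength :
    Continuous (strength : X × Hyperspace Y → Hyperspace (X × Y)) := by
  refine continuous_iff_hit.2 fun W => isOpen_iff_mem_nhds.2 ?_
  rintro ⟨x, C⟩ h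
  obtain ⟨y, hy, hW⟩ := (strength_mem_hit _ _).1 h
  obtain ⟨U, V, hU, hV, hx, hyV, hUV⟩ := isOpen_prod_iff.1 W.isOpen x y hW
  filter_upwards [(hU.prod (isOpen_hit ⟨V, hV⟩)).mem_nhds ⟨hx, y, hy, hyV⟩] with p hp
  obtain ⟨h1, z, hz, hzV⟩ := hp
  exact (strength_mem_hit _ _).2 ⟨z, hz, hUV ⟨h1, hzV⟩⟩

end Basic

section Bundled
variable (X Y : Type u) [TopologicalSpace X] [TopologicalSpace Y]

/-- `f_♯` as a continuous map. -/
def mapC {X Y : Type u} [TopologicalSpace X] [TopologicalSpace Y] (f : C(X, Y)) :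
    C(Hyperspace X, Hyperspace Y) := ⟨map f, continuous_map f⟩

/-- The closure of a point as a continuous map. -/
def pointC : C(X, Hyperspace X) := ⟨point, continuous_point⟩

/-- The closure of the union as a continuous map. -/
def unionC : C(Hyperspace (Hyperspace X), Hyperspace X) := ⟨union, continuous_union⟩

/-- The strength as a continuous map. -/
def strengthC : C(X × Hyperspace Y, Hyperspace (X × Y)) := ⟨strength, continuous_strength⟩

variable {X Y}

theorem comap_mapC (f : C(X, Y)) (U : Opens Y) :
    (hitOpen U).comap (mapC f) = hitOpen (U.comap f) :=
  Opens.ext (Set.ext fun C => map_mem_hit f C U)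

theorem comap_pointC (U : Opens X) : (hitOpen U).comap (pointC X) = U :=
  Opens.ext (Set.ext fun x => point_mem_hit x U)

theorem comap_unionC (U : Opens X) : (hitOpen U).comap (unionC X) = hitOpen (hitOpen U) :=
  Opens.ext (Set.ext fun K => union_mem_hit K U)

theorem map_map {Z : Type u} [TopologicalSpace Z] (f : C(X, Y)) (g : C(Y, Z)) (C : Hyperspace X) :
    map g (map f C) = map (g.comp f) C :=
  ext_hit fun U => by rw [map_mem_hit, map_mem_hit, map_mem_hit, Opens.comap_comp]; rfl

theorem map_id (C : Hyperspace X) : map (ContinuousMap.id X) C = C :=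
  ext_hit fun U => map_mem_hit _ _ _

theorem map_point (f : C(X, Y)) (x : X) : map f (point x) = point (f x) :=
  ext_hit fun U => by rw [map_mem_hit, point_mem_hit, point_mem_hit]; rfl

theorem union_map_map (f : C(X, Y)) (K : Hyperspace (Hyperspace X)) :
    union (map (mapC f) K) = map f (union K) :=
  ext_hit fun U => by
    rw [union_mem_hit, map_mem_hit, map_mem_hit, union_mem_hit, comap_mapC]

theorem union_map_union (K : Hyperspace (Hyperspace (Hyperspace X))) :
    union (map (unionC X) K) = union (union K) :=
  ext_hit fun U => by
    rw [union_mem_hit, map_mem_hit, union_mem_hit, union_mem_hit, comap_unionC]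

theorem union_point (C : Hyperspace X) : union (point C) = C :=
  ext_hit fun U => by rw [union_mem_hit, point_mem_hit]; rfl

theorem union_map_point (C : Hyperspace X) : union (map (pointC X) C) = C :=
  ext_hit fun U => by rw [union_mem_hit, map_mem_hit, comap_pointC]

theorem union_map_strength (x : X) (K : Hyperspace (Hyperspace Y)) :
    union (map (strengthC X Y) (strength (x, K))) = strength (x, union K) :=
  ext_hit fun W => by
    have h : ((hitOpen W).comap (strengthC X Y)).comap (ContValuation.slice x) =
        hitOpen (W.comap (ContValuation.slice x)) :=
      Opens.ext (Set.ext fun C => strength_mem_hit (x, C) W)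
    rw [union_mem_hit, map_mem_hit, strength_mem_hit, strength_mem_hit, union_mem_hit, h]

end Bundled

end Hyperspace

namespace ContValuation

section Support
variable {X Y : Type u} [TopologicalSpace X] [TopologicalSpace Y]

/-- The support of a valuation: the points all of whose open neighbourhoods have positive mass. -/
def support (ν : ContValuation X) : Hyperspace X :=
  (⟨{x | ∀ U : Opens X, x ∈ U → 0 < ν U}, by
    rw [← isOpen_compl_iff, isOpen_iff_mem_nhds]
    intro x hx
    simp only [Set.mem_compl_iff, Set.mem_ofPred_eq, not_forall] at hx
    obtain ⟨U, hU, h0⟩ := hx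
    filter_upwards [U.isOpen.mem_nhds hU] with y hy h
    exact h0 (h U hy)⟩ : Closeds X)

theorem mem_support {ν : ContValuation X} {x : X} :
    x ∈ support ν ↔ ∀ U : Opens X, x ∈ U → 0 < ν U := Iff.rfl

/-- The support hits exactly the open sets of positive mass. -/
theorem support_mem_hit (ν : ContValuation X) (U : Opens X) :
    support ν ∈ Hyperspace.hit U ↔ 0 < ν U := by
  constructor
  · rintro ⟨x, hx, hU⟩
    exact mem_support.1 hx U hU
  · intro h
    by_contra hne
    let D : Set (Opens X) := {V | ν V = 0}
    have hle : U ≤ sSup D := by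
      intro x hxU
      have hx : x ∉ support ν := fun hx => hne ⟨x, hx, hxU⟩
      simp only [mem_support, not_forall, not_lt, nonpos_iff_eq_zero] at hx
      obtain ⟨V, hV, h0⟩ := hx
      exact Opens.mem_sSup.2 ⟨V, h0, hV⟩
    have hdir : DirectedOn (· ≤ ·) D := by
      intro V hV W hW
      refine ⟨V ⊔ W, ?_, le_sup_left, le_sup_right⟩
      have h1 := ν.modular' V W
      rw [show ν V = 0 from hV, show ν W = 0 from hW, add_zero] at h1
      exact (add_eq_zero.1 h1).1
    have h0 : ν (sSup D) = 0 := by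
      rw [ν.scott' D ⟨⊥, ν.map_bot'⟩ hdir]
      exact bot_le.antisymm' (iSup₂_le fun V hV => le_of_eq hV)
    exact absurd (ν.mono' hle) (by rw [h0]; exact not_le.2 h)

theorem continuous_support : Continuous (support : ContValuation X → Hyperspace X) := by
  refine Hyperspace.continuous_iff_hit.2 fun U => ?_
  have : support ⁻¹' Hyperspace.hit U = theta U 0 := Set.ext fun ν => by
    rw [Set.mem_preimage, support_mem_hit]; rfl
  rw [this]
  exact isOpen_generateFrom_of_mem ⟨U, 0, rfl⟩

theorem support_map (f : C(X, Y)) (ν : ContValuation X) :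
    support (map f ν) = Hyperspace.map f (support ν) :=
  Hyperspace.ext_hit fun U => by
    rw [support_mem_hit, Hyperspace.map_mem_hit, support_mem_hit, map_apply]

end Support

end ContValuation

/-- The monad of continuous valuations on the category of topological spaces. -/
noncomputable def valuationMonad : Monad TopCat.{u} where
  obj X := TopCat.of (ContValuation X)
  map f := TopCat.ofHom (ContValuation.mapC f.hom)
  map_id X := rfl
  map_comp f g := rfl
  η :=
    { app := fun X => TopCat.ofHom (ContValuation.diracC X)
      naturality := fun X Y f => rfl }
  μ :=
    { app := fun X => TopCat.ofHom (ContValuation.joinC X)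
      naturality := fun X Y f =>
        TopCat.hom_ext (ContinuousMap.ext fun ξ => ContValuation.join_map_map f.hom ξ) }
  assoc X := TopCat.hom_ext (ContinuousMap.ext fun ξ => ContValuation.join_map_join ξ)
  left_unit X := TopCat.hom_ext (ContinuousMap.ext fun ν => ContValuation.join_dirac ν)
  right_unit X := TopCat.hom_ext (ContinuousMap.ext fun ν => ContValuation.join_map_dirac ν)

/-- The hyperspace monad on the category of topological spaces. -/
def hyperspaceMonad : Monad TopCat.{u} where
  obj X := TopCat.of (Hyperspace X)
  map f := TopCat.ofHom (Hyperspace.mapC f.hom)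
  map_id X := TopCat.hom_ext (ContinuousMap.ext fun C => Hyperspace.map_id C)
  map_comp f g :=
    TopCat.hom_ext (ContinuousMap.ext fun C => (Hyperspace.map_map f.hom g.hom C).symm)
  η :=
    { app := fun X => TopCat.ofHom (Hyperspace.pointC X)
      naturality := fun X Y f =>
        TopCat.hom_ext (ContinuousMap.ext fun x => (Hyperspace.map_point f.hom x).symm) }
  μ :=
    { app := fun X => TopCat.ofHom (Hyperspace.unionC X)
      naturality := fun X Y f =>
        TopCat.hom_ext (ContinuousMap.ext fun K => Hyperspace.union_map_map f.hom K) }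
  assoc X := TopCat.hom_ext (ContinuousMap.ext fun K => Hyperspace.union_map_union K)
  left_unit X := TopCat.hom_ext (ContinuousMap.ext fun C => Hyperspace.union_point C)
  right_unit X := TopCat.hom_ext (ContinuousMap.ext fun C => Hyperspace.union_map_point C)

/-- A strength on a monad `T` on a monoidal category: a natural family `X ⊗ TY ⟶ T(X ⊗ Y)`
compatible with the unitor, the associator, and the unit and multiplication of `T`. -/
structure Strength {C : Type*} [Category C] [MonoidalCategory C] (T : Monad C) where
  str : ∀ X Y : C, X ⊗ T.obj Y ⟶ T.obj (X ⊗ Y)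
  natural_left : ∀ {X Z : C} (f : X ⟶ Z) (Y : C),
    f ▷ T.obj Y ≫ str Z Y = str X Y ≫ T.map (f ▷ Y)
  natural_right : ∀ (X : C) {Y W : C} (g : Y ⟶ W),
    X ◁ T.map g ≫ str X W = str X Y ≫ T.map (X ◁ g)
  unitor : ∀ X : C, str (𝟙_ C) X ≫ T.map (λ_ X).hom = (λ_ (T.obj X)).hom
  associator : ∀ X Y Z : C, str (X ⊗ Y) Z ≫ T.map (α_ X Y Z).hom =
    (α_ X Y (T.obj Z)).hom ≫ X ◁ str Y Z ≫ str X (Y ⊗ Z)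
  unit : ∀ X Y : C, X ◁ T.η.app Y ≫ str X Y = T.η.app (X ⊗ Y)
  mul : ∀ X Y : C, str X (T.obj Y) ≫ T.map (str X Y) ≫ T.μ.app (X ⊗ Y) =
    X ◁ T.μ.app Y ≫ str X Y

namespace Strength

variable {C : Type*} [Category C] [MonoidalCategory C] [BraidedCategory C] {T : Monad C}

/-- The costrength `TX ⊗ Y ⟶ T(X ⊗ Y)` induced by a strength by symmetry. -/
def costr (s : Strength T) (X Y : C) : T.obj X ⊗ Y ⟶ T.obj (X ⊗ Y) :=
  (β_ (T.obj X) Y).hom ≫ s.str Y X ≫ T.map (β_ Y X).hom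

/-- The map `∇ : TX ⊗ TY ⟶ T(X ⊗ Y)` induced by a strength:
`TX ⊗ TY ⟶ T(TX ⊗ Y) ⟶ TT(X ⊗ Y) ⟶ T(X ⊗ Y)`. -/
def nabla (s : Strength T) (X Y : C) : T.obj X ⊗ T.obj Y ⟶ T.obj (X ⊗ Y) :=
  s.str (T.obj X) Y ≫ T.map (s.costr X Y) ≫ T.μ.app (X ⊗ Y)

end Strength

/-- The strength `X × VY → V(X × Y)`, `(x, ν) ↦ (j_x)_* ν`, of the valuation monad. -/
noncomputable def valuationStrength : Strength valuationMonad.{u} where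
  str X Y := TopCat.ofHom (ContValuation.strengthC X Y)
  natural_left f Y := rfl
  natural_right X _ _ g := rfl
  unitor X := rfl
  associator X Y Z := rfl
  unit X Y := rfl
  mul X Y := TopCat.hom_ext (ContinuousMap.ext fun p => ContValuation.join_map_strength p.1 p.2)

/-- The strength `X × HY → H(X × Y)`, `(x, C) ↦ (j_x)_♯ C`, of the hyperspace monad. -/
def hyperspaceStrength : Strength hyperspaceMonad.{u} where
  str X Y := TopCat.ofHom (Hyperspace.strengthC X Y)
  natural_left f Y := TopCat.hom_ext (ContinuousMap.ext fun p =>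
    (Hyperspace.map_map (ContValuation.slice p.1) (f ▷ Y).hom p.2).symm)
  natural_right X _ _ g := TopCat.hom_ext (ContinuousMap.ext fun p =>
    (Hyperspace.map_map g.hom (ContValuation.slice p.1) p.2).trans
      (Hyperspace.map_map (ContValuation.slice p.1) (X ◁ g).hom p.2).symm)
  unitor X := TopCat.hom_ext (ContinuousMap.ext fun p =>
    (Hyperspace.map_map (ContValuation.slice p.1) (λ_ X).hom.hom p.2).trans
      (Hyperspace.map_id p.2))
  associator X Y Z := TopCat.hom_ext (ContinuousMap.ext fun p =>
    (Hyperspace.map_map (ContValuation.slice p.1) (α_ X Y Z).hom.hom p.2).trans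
      (Hyperspace.map_map (ContValuation.slice p.1.2) (ContValuation.slice p.1.1) p.2).symm)
  unit X Y := TopCat.hom_ext (ContinuousMap.ext fun p =>
    Hyperspace.map_point (ContValuation.slice p.1) p.2)
  mul X Y := TopCat.hom_ext (ContinuousMap.ext fun p => Hyperspace.union_map_strength p.1 p.2)

/-- The support, as a natural transformation `V ⟶ H`. -/
def supp : valuationMonad.{u}.toFunctor ⟶ hyperspaceMonad.{u}.toFunctor where
  app X := TopCat.ofHom ⟨ContValuation.support, ContValuation.continuous_support⟩
  naturality X Y f := by
    ext ν : 2
    exact ContValuation.support_map f.hom ν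

/-- The product valuation: the image of `(ν, ρ)` under `∇ : VX × VY → V(X × Y)`. -/
noncomputable def ContValuation.prod {X Y : Type u} [TopologicalSpace X] [TopologicalSpace Y]
    (ν : ContValuation X) (ρ : ContValuation Y) : ContValuation (X × Y) :=
  (valuationStrength.nabla (TopCat.of X) (TopCat.of Y)).hom (ν, ρ)

/-- The opmonoidal structure of `V` for the cartesian product: marginalization
`V(X × Y) → VX × VY`, induced by the two projections. -/
noncomputable instance : valuationMonad.{u}.toFunctor.OplaxMonoidal := .ofChosenFiniteProducts _

/-- The opmonoidal structure of `H` for the cartesian product: projection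
`H(X × Y) → HX × HY`, induced by the two projections. -/
noncomputable instance : hyperspaceMonad.{u}.toFunctor.OplaxMonoidal := .ofChosenFiniteProducts _

/-- A natural transformation between opmonoidal (oplax monoidal) functors is opmonoidal if it is
compatible with the counit maps and the comultiplication maps. -/
structure IsOpmonoidal {C D : Type*} [Category C] [MonoidalCategory C] [Category D]
    [MonoidalCategory D] {F G : C ⥤ D} [F.OplaxMonoidal] [G.OplaxMonoidal] (τ : F ⟶ G) : Prop where
  counit : τ.app (𝟙_ C) ≫ Functor.OplaxMonoidal.η G = Functor.OplaxMonoidal.η F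
  comul : ∀ X Y : C, Functor.OplaxMonoidal.δ F X Y ≫ (τ.app X ⊗ₘ τ.app Y) =
    τ.app (X ⊗ Y) ≫ Functor.OplaxMonoidal.δ G X Y

/-! Everything is tested on open sets. A closed set is determined by the open sets it hits, and the
support of `ν` hits `U` exactly when `0 < ν U`; an identity between supports thus becomes a
statement about which values of valuations are positive.

The claims on strengths and on marginals are instances of naturality (`support_map`): both strengths
are pushforwards along the same slice inclusion, and marginals are pushforwards along the
projections. Opmonoidality is formal, because any natural transformation respects maps induced by
product projections.

The substance lies in the lax monoidal structures, where it suffices to test on open rectangles. For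
`H`, the product of two closed sets hits `U × V` iff the factors hit `U` and `V`
(`Hyperspace.prod_mem_hit_rect`). For `V`, iterated integration gives `ν U * ρ V` on `U × V`
(`ContValuation.prod_rect`). A product in `[0, ∞]` is positive iff both factors are, which makes the
support monoidal (`support_prod`) and gives the set-level product formula (`coe_support_prod`).

Rectangles determine a valuation because they form a basis closed under binary intersections:
modularity extends agreement to finite unions, and Scott continuity to all open sets
(`ext_of_isBasis`). Finiteness of the valuations is not needed. The coherence laws for `V` then
reduce to associativity, commutativity and unitality of multiplication in `[0, ∞]`; in particular
symmetry, which is Fubini's theorem here, requires no separate exchange of integrals. Those for `H`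
reduce to the same laws for conjunction. -/

namespace TopologicalSpace.Opens

/-! ### Open rectangles -/

variable {X Y : Type*} [TopologicalSpace X] [TopologicalSpace Y]

/-- The open rectangle `U × V`. -/
def rect (U : Opens X) (V : Opens Y) : Opens (X × Y) :=
  ⟨(U : Set X) ×ˢ (V : Set Y), U.isOpen.prod V.isOpen⟩

theorem mem_rect {U : Opens X} {V : Opens Y} {p : X × Y} :
    p ∈ rect U V ↔ p.1 ∈ U ∧ p.2 ∈ V := Iff.rfl

theorem rect_inf_rect (U U' : Opens X) (V V' : Opens Y) :
    rect U V ⊓ rect U' V' = rect (U ⊓ U') (V ⊓ V') :=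
  Opens.ext Set.prod_inter_prod

theorem isBasis_univ : IsBasis (Set.univ : Set (Opens X)) :=
  isBasis_iff_nbhd.2 fun {U _} hx => ⟨U, trivial, hx, le_rfl⟩

/-- Arbitrary bases of the factors, rather than all open sets, are allowed so that the construction
can be iterated to give boxes in a triple product. `infClosed_rect` has the same form for the same
reason. -/
theorem IsBasis.rect {A : Set (Opens X)} {B : Set (Opens Y)} (hA : IsBasis A) (hB : IsBasis B) :
    IsBasis (Set.image2 Opens.rect A B) := by
  rw [isBasis_iff_nbhd]
  rintro W ⟨x, y⟩ h
  obtain ⟨U, V, hU, hV, hx, hy, hUV⟩ := isOpen_prod_iff.1 W.isOpen x y h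
  obtain ⟨U', hU', hx', hUU'⟩ := isBasis_iff_nbhd.1 hA (U := ⟨U, hU⟩) hx
  obtain ⟨V', hV', hy', hVV'⟩ := isBasis_iff_nbhd.1 hB (U := ⟨V, hV⟩) hy
  exact ⟨U'.rect V', ⟨U', hU', V', hV', rfl⟩, ⟨hx', hy'⟩,
    fun p hp => hUV ⟨hUU' hp.1, hVV' hp.2⟩⟩

theorem infClosed_rect {A : Set (Opens X)} {B : Set (Opens Y)} (hA : InfClosed A)
    (hB : InfClosed B) : InfClosed (Set.image2 Opens.rect A B) := by
  rintro _ ⟨U, hU, V, hV, rfl⟩ _ ⟨U', hU', V', hV', rfl⟩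
  exact ⟨_, hA hU hU', _, hB hV hV', (rect_inf_rect U U' V V').symm⟩

end TopologicalSpace.Opens

/-! ### Products in the hyperspace -/

namespace Hyperspace

variable {X Y Z : Type u} [TopologicalSpace X] [TopologicalSpace Y] [TopologicalSpace Z]

/-- A witness that a closed set hits `U` has a basic neighbourhood inside `U`. Since hitting only
asks for one point, the basis need not be closed under intersections, in contrast to the case of
valuations. -/
theorem ext_hit_of_isBasis {B : Set (Opens X)} (hB : Opens.IsBasis B) {C D : Hyperspace X}
    (h : ∀ U ∈ B, C ∈ hit U ↔ D ∈ hit U) : C = D := by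
  have key : ∀ {C D : Hyperspace X}, (∀ U ∈ B, C ∈ hit U → D ∈ hit U) →
      ∀ U, C ∈ hit U → D ∈ hit U := by
    rintro C D h U ⟨x, hx, hxU⟩
    obtain ⟨V, hV, hxV, hVU⟩ := Opens.isBasis_iff_nbhd.1 hB hxU
    obtain ⟨y, hy, hyV⟩ := h V hV ⟨x, hx, hxV⟩
    exact ⟨y, hy, hVU hyV⟩
  exact ext_hit fun U => ⟨key (fun V hV => (h V hV).1) U, key (fun V hV => (h V hV).2) U⟩

theorem ext_hit_rect {C D : Hyperspace (X × Y)}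
    (h : ∀ U V, C ∈ hit (Opens.rect U V) ↔ D ∈ hit (Opens.rect U V)) : C = D := by
  refine ext_hit_of_isBasis (Opens.isBasis_univ.rect Opens.isBasis_univ) ?_
  rintro _ ⟨U, -, V, -, rfl⟩
  exact h U V

/-- The bracketing is that of the target of the associator. -/
theorem ext_hit_rect_rect {C D : Hyperspace (X × (Y × Z))}
    (h : ∀ U V W, C ∈ hit (Opens.rect U (Opens.rect V W)) ↔
      D ∈ hit (Opens.rect U (Opens.rect V W))) : C = D := by
  refine ext_hit_of_isBasis
    (Opens.isBasis_univ.rect (Opens.isBasis_univ.rect Opens.isBasis_univ)) ?_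
  rintro _ ⟨U, -, _, ⟨V, -, W, -, rfl⟩, rfl⟩
  exact h U V W

/-- The product of two closed sets, as the image of `(C, D)` under `∇ : HX × HY → H(X × Y)`. -/
def prod (C : Hyperspace X) (D : Hyperspace Y) : Hyperspace (X × Y) :=
  (hyperspaceStrength.nabla (TopCat.of X) (TopCat.of Y)).hom (C, D)

/-- Each of the three maps composing `∇` pulls a hit condition back to a hit condition. The outer
strength contributes the choice of `y ∈ D`, the costrength then that of `x ∈ C`. -/
theorem prod_mem_hit (C : Hyperspace X) (D : Hyperspace Y) (W : Opens (X × Y)) :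
    prod C D ∈ hit W ↔ ∃ y ∈ D, ∃ x ∈ C, (x, y) ∈ W := by
  have e : ∀ y, (hyperspaceStrength.costr (TopCat.of X) (TopCat.of Y)).hom (C, y) ∈ hit W ↔
      ∃ x ∈ C, (x, y) ∈ W := fun y =>
    (map_mem_hit _ (strength (y, C)) W).trans (strength_mem_hit (y, C) _)
  refine ((union_mem_hit _ W).trans ((map_mem_hit _ (strength (C, D)) _).trans
    (strength_mem_hit (C, D) _))).trans ?_
  exact exists_congr fun y => and_congr_right fun _ => e y

/-- On a rectangle the two existential conditions decouple. All laws for the product of closed sets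
below use only this criterion. -/
theorem prod_mem_hit_rect (C : Hyperspace X) (D : Hyperspace Y) (U : Opens X) (V : Opens Y) :
    prod C D ∈ hit (Opens.rect U V) ↔ C ∈ hit U ∧ D ∈ hit V := by
  rw [prod_mem_hit]
  constructor
  · rintro ⟨y, hy, x, hx, hU, hV⟩
    exact ⟨⟨x, hx, hU⟩, ⟨y, hy, hV⟩⟩
  · rintro ⟨⟨x, hx, hU⟩, ⟨y, hy, hV⟩⟩
    exact ⟨y, hy, x, hx, hU, hV⟩

theorem prod_map_map {X' Y' : Type u} [TopologicalSpace X'] [TopologicalSpace Y'] (f : C(X, X'))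
    (g : C(Y, Y')) (C : Hyperspace X) (D : Hyperspace Y) :
    prod (map f C) (map g D) = map (f.prodMap g) (prod C D) :=
  ext_hit_rect fun U V => by
    rw [prod_mem_hit_rect, map_mem_hit, map_mem_hit, map_mem_hit, ← prod_mem_hit_rect]
    rfl

/-- The reassociation map is specified by its values only, so that the associator of `TopCat` can be
substituted directly. -/
theorem map_assoc_prod (f : C((X × Y) × Z, X × (Y × Z))) (hf : ∀ p, f p = (p.1.1, p.1.2, p.2))
    (C : Hyperspace X) (D : Hyperspace Y) (E : Hyperspace Z) :
    map f (prod (prod C D) E) = prod C (prod D E) :=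
  ext_hit_rect_rect fun U V W => by
    have e : (Opens.rect U (Opens.rect V W)).comap f = Opens.rect (Opens.rect U V) W :=
      Opens.ext (Set.ext fun p => by simp [hf, Opens.mem_rect, and_assoc])
    rw [map_mem_hit, e, prod_mem_hit_rect, prod_mem_hit_rect, prod_mem_hit_rect,
      prod_mem_hit_rect, and_assoc]

/-- The preimage of `U` is the rectangle `⊤ × U`, and the closure of a point always hits `⊤`. -/
theorem map_snd_prod_point (x : X) (C : Hyperspace Y) :
    map (ContinuousMap.snd : C(X × Y, Y)) (prod (point x) C) = C :=
  ext_hit fun U => by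
    have e : U.comap (ContinuousMap.snd : C(X × Y, Y)) = Opens.rect ⊤ U :=
      Opens.ext (Set.ext fun _ => (and_iff_right trivial).symm)
    rw [map_mem_hit, e, prod_mem_hit_rect, point_mem_hit]
    exact and_iff_right trivial

theorem map_fst_prod_point (C : Hyperspace X) (y : Y) :
    map (ContinuousMap.fst : C(X × Y, X)) (prod C (point y)) = C :=
  ext_hit fun U => by
    have e : U.comap (ContinuousMap.fst : C(X × Y, X)) = Opens.rect U ⊤ :=
      Opens.ext (Set.ext fun _ => (and_iff_left trivial).symm)
    rw [map_mem_hit, e, prod_mem_hit_rect, point_mem_hit]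
    exact and_iff_left trivial

theorem map_swap_prod (C : Hyperspace X) (D : Hyperspace Y) :
    map ContinuousMap.prodSwap (prod C D) = prod D C :=
  ext_hit_rect fun V U => by
    have e : (Opens.rect V U).comap ContinuousMap.prodSwap = Opens.rect U V :=
      Opens.ext (Set.ext fun _ => and_comm)
    rw [map_mem_hit, e, prod_mem_hit_rect, prod_mem_hit_rect, and_comm]

end Hyperspace

namespace ContValuation

/-! ### Valuations are determined by an intersection-closed basis -/

section Ext
variable {X Y Z : Type u} [TopologicalSpace X] [TopologicalSpace Y] [TopologicalSpace Z]
  {ν ρ : ContValuation X} {B : Set (Opens X)}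

/-- Inclusion-exclusion, organized as strong induction on the number of sets. Splitting off one
member `U`, modularity expresses the union through `U`, the union of the rest, and their
intersection; the latter is again a union of fewer members of `B`. -/
theorem finset_sup_eq_of_infClosed (hB : InfClosed B) (h : ∀ U ∈ B, ν U = ρ U)
    (t : Finset (Opens X)) (ht : ∀ U ∈ t, U ∈ B) : ν (t.sup id) = ρ (t.sup id) := by
  classical
  induction hn : t.card using Nat.strong_induction_on generalizing t with
  | _ n ih =>
    subst hn
    obtain rfl | ⟨U, hU⟩ := t.eq_empty_or_nonempty
    · simp [map_bot']
    · set s := t.erase U with hs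
      have hcard : s.card < t.card := Finset.card_erase_lt_of_mem hU
      have hsB : ∀ V ∈ s, V ∈ B := fun V hV => ht V (Finset.mem_of_mem_erase hV)
      have e1 : ν (s.sup id) = ρ (s.sup id) := ih _ hcard s hsB rfl
      have e2 : ν (U ⊓ s.sup id) = ρ (U ⊓ s.sup id) := by
        -- Distributivity. Some intersections may coincide, so the image can be smaller than `s`;
        -- the bound on its cardinality is all the induction needs.
        have he : U ⊓ s.sup id = (s.image (U ⊓ ·)).sup id := by
          rw [Finset.sup_inf_distrib_left, Finset.sup_image]
          rfl
        rw [he]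
        refine ih _ (Finset.card_image_le.trans_lt hcard) _ ?_ rfl
        simp only [Finset.mem_image, forall_exists_index, and_imp]
        rintro _ V hV rfl
        exact hB (ht U hU) (hsB V hV)
      have hsup : t.sup id = U ⊔ s.sup id := by
        rw [← Finset.insert_erase hU, Finset.sup_insert, ← hs]; rfl
      have m1 := ν.modular' U (s.sup id)
      have m2 := ρ.modular' U (s.sup id)
      rw [hsup]
      -- Modularity can be solved for the union only if the intersection has finite value. If that
      -- value is infinite, monotonicity makes both valuations infinite on the union.
      by_cases htop : ν (U ⊓ s.sup id) = ⊤
      · have hle : U ⊓ s.sup id ≤ U ⊔ s.sup id := inf_le_left.trans le_sup_left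
        have h1 := ν.mono' hle
        have h2 := ρ.mono' hle
        rw [htop, top_le_iff] at h1
        rw [← e2, htop, top_le_iff] at h2
        rw [h1, h2]
      · rw [h U (ht U hU), e1, ← m2, ← e2] at m1
        exact (ENNReal.add_left_inj htop).1 m1

/-- A continuous valuation is determined by its values on a basis that is closed under binary
intersections. -/
theorem ext_of_isBasis (hB : InfClosed B) (hB' : Opens.IsBasis B) (h : ∀ U ∈ B, ν U = ρ U) :
    ν = ρ := by
  classical
  refine ext fun U => ?_
  -- The finite unions of basic sets inside `U` form a directed family with union `U`, so Scott
  -- continuity applies.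
  let T := {t : Finset (Opens X) // ∀ V ∈ t, V ∈ B ∧ V ≤ U}
  have : Nonempty T := ⟨⟨∅, by simp⟩⟩
  have hU : U = ⨆ t : T, t.1.sup id := by
    refine le_antisymm (fun x hx => ?_)
      (iSup_le fun t => Finset.sup_le fun V hV => (t.2 V hV).2)
    obtain ⟨V, hV, hxV, hVU⟩ := Opens.isBasis_iff_nbhd.1 hB' hx
    rw [Opens.mem_iSup]
    exact ⟨⟨{V}, by simp [hV, hVU]⟩, by simpa using hxV⟩
  have hd : Directed (· ≤ ·) (fun t : T => t.1.sup id) := by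
    rintro ⟨s, hs⟩ ⟨t, ht⟩
    refine ⟨⟨s ∪ t, fun V hV => ?_⟩, Finset.sup_mono Finset.subset_union_left,
      Finset.sup_mono Finset.subset_union_right⟩
    exact (Finset.mem_union.1 hV).elim (hs V) (ht V)
  rw [hU, ν.scott_iSup _ hd, ρ.scott_iSup _ hd]
  exact iSup_congr fun t => finset_sup_eq_of_infClosed hB h t.1 fun V hV => (t.2 V hV).1

theorem ext_rect {ν ρ : ContValuation (X × Y)}
    (h : ∀ U V, ν (Opens.rect U V) = ρ (Opens.rect U V)) :
    ν = ρ := by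
  refine ext_of_isBasis (Opens.infClosed_rect infClosed_univ infClosed_univ)
    (Opens.isBasis_univ.rect Opens.isBasis_univ) ?_
  rintro _ ⟨U, -, V, -, rfl⟩
  exact h U V

theorem ext_rect_rect {ν ρ : ContValuation (X × (Y × Z))}
    (h : ∀ U V W, ν (Opens.rect U (Opens.rect V W)) = ρ (Opens.rect U (Opens.rect V W))) :
    ν = ρ := by
  refine ext_of_isBasis (Opens.infClosed_rect infClosed_univ
      (Opens.infClosed_rect infClosed_univ infClosed_univ))
    (Opens.isBasis_univ.rect (Opens.isBasis_univ.rect Opens.isBasis_univ)) ?_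
  rintro _ ⟨U, -, _, ⟨V, -, W, -, rfl⟩, rfl⟩
  exact h U V W

end Ext

/-! ### The product valuation and its support -/

section Product
variable {X Y Z : Type u} [TopologicalSpace X] [TopologicalSpace Y] [TopologicalSpace Z]

/-- The product valuation is computed by iterated integration. -/
theorem prod_apply (ν : ContValuation X) (ρ : ContValuation Y) (W : Opens (X × Y)) :
    ν.prod ρ W = lowerIntegral ρ
      (fun y => strength (y, ν) (W.comap (⟨Prod.swap, continuous_swap⟩ : C(Y × X, X × Y)))) :=
  -- The multiplication integrates evaluation at `W`; the change of variables formula is applied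
  -- first to the costrength, then to the slice at `ν`.
  (lowerIntegral_map (valuationStrength.costr (TopCat.of X) (TopCat.of Y)).hom
      (strength (ν, ρ)) (lsc_eval W)).trans
    (lowerIntegral_map (slice ν) ρ ((lsc_eval W).comp
      (valuationStrength.costr (TopCat.of X) (TopCat.of Y)).hom.continuous))

/-- The section of `U × V` at `y` is `U` if `y ∈ V` and empty otherwise, so the inner integral is
the constant `ν U` times the indicator of `V`. The convention `∞ * 0 = 0` covers infinite `ν U`. -/
theorem prod_rect (ν : ContValuation X) (ρ : ContValuation Y) (U : Opens X) (V : Opens Y) :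
    ν.prod ρ (Opens.rect U V) = ν U * ρ V := by
  have : (fun y => strength (y, ν)
      ((Opens.rect U V).comap (⟨Prod.swap, continuous_swap⟩ : C(Y × X, X × Y)))) =
      fun y => ν U * ind V y := by
    funext y
    rw [strength, map_apply]
    by_cases hy : y ∈ V
    · rw [ind, Set.indicator_of_mem (by exact hy), Pi.one_apply, mul_one]
      congr 1
      ext x
      exact and_iff_left hy
    · rw [ind, Set.indicator_of_notMem (by exact hy), mul_zero, ← ν.map_bot']
      congr 1
      ext x
      exact iff_of_false (fun h => hy h.2) id
  rw [prod_apply, this, lowerIntegral_mul _ _ (ind_lsc V), lowerIntegral_ind]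

theorem coe_support_prod (ν : ContValuation X) (ρ : ContValuation Y) :
    ((ν.prod ρ).support : Set (X × Y)) = (ν.support : Set X) ×ˢ (ρ.support : Set Y) := by
  ext ⟨x, y⟩
  simp only [Set.mem_prod, SetLike.mem_coe, mem_support]
  constructor
  · refine fun h => ⟨fun U hU => ?_, fun V hV => ?_⟩
    -- Taking the whole space as other side isolates one factor: a positive product has positive
    -- factors.
    · have := h (Opens.rect U ⊤) ⟨hU, trivial⟩
      rw [prod_rect] at this
      exact pos_of_ne_zero (left_ne_zero_of_mul this.ne')
    · have := h (Opens.rect ⊤ V) ⟨trivial, hV⟩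
      rw [prod_rect] at this
      exact pos_of_ne_zero (right_ne_zero_of_mul this.ne')
  · rintro ⟨hx, hy⟩ W hW
    obtain ⟨U, V, hU, hV, hxU, hyV, hUV⟩ := isOpen_prod_iff.1 W.isOpen x y hW
    refine lt_of_lt_of_le ?_ ((ν.prod ρ).mono' (show Opens.rect ⟨U, hU⟩ ⟨V, hV⟩ ≤ W from hUV))
    rw [prod_rect]
    exact ENNReal.mul_pos (hx ⟨U, hU⟩ hxU).ne' (hy ⟨V, hV⟩ hyV).ne'

/-- The same positivity argument, phrased with the map `∇` of `H` as the tensor axiom of a monoidal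
transformation requires. -/
theorem support_prod (ν : ContValuation X) (ρ : ContValuation Y) :
    (ν.prod ρ).support = Hyperspace.prod ν.support ρ.support :=
  Hyperspace.ext_hit_rect fun U V => by
    rw [Hyperspace.prod_mem_hit_rect, support_mem_hit, support_mem_hit, support_mem_hit, prod_rect,
      pos_iff_ne_zero, pos_iff_ne_zero, pos_iff_ne_zero, mul_ne_zero_iff]

theorem prod_map_map {X' Y' : Type u} [TopologicalSpace X'] [TopologicalSpace Y'] (f : C(X, X'))
    (g : C(Y, Y')) (ν : ContValuation X) (ρ : ContValuation Y) :
    (map f ν).prod (map g ρ) = map (f.prodMap g) (ν.prod ρ) :=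
  ext_rect fun U V => (prod_rect (map f ν) (map g ρ) U V).trans
    (prod_rect ν ρ (U.comap f) (V.comap g)).symm

theorem map_assoc_prod (f : C((X × Y) × Z, X × (Y × Z))) (hf : ∀ p, f p = (p.1.1, p.1.2, p.2))
    (ν : ContValuation X) (ρ : ContValuation Y) (σ : ContValuation Z) :
    map f ((ν.prod ρ).prod σ) = ν.prod (ρ.prod σ) :=
  ext_rect_rect fun U V W => by
    have e : (Opens.rect U (Opens.rect V W)).comap f = Opens.rect (Opens.rect U V) W :=
      Opens.ext (Set.ext fun p => by simp [hf, Opens.mem_rect, and_assoc])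
    rw [map_apply, e, prod_rect, prod_rect, prod_rect, prod_rect, mul_assoc]

theorem map_snd_prod_dirac (x : X) (ν : ContValuation Y) :
    map ContinuousMap.snd ((dirac x).prod ν) = ν :=
  ext fun U => by
    have e : U.comap (ContinuousMap.snd : C(X × Y, Y)) = Opens.rect ⊤ U :=
      Opens.ext (Set.ext fun _ => (and_iff_right trivial).symm)
    have h : dirac x ⊤ = 1 := Set.indicator_of_mem (Set.mem_univ x) _
    rw [map_apply, e, prod_rect, h, one_mul]

theorem map_fst_prod_dirac (ν : ContValuation X) (y : Y) :
    map ContinuousMap.fst (ν.prod (dirac y)) = ν :=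
  ext fun U => by
    have e : U.comap (ContinuousMap.fst : C(X × Y, X)) = Opens.rect U ⊤ :=
      Opens.ext (Set.ext fun _ => (and_iff_left trivial).symm)
    have h : dirac y ⊤ = 1 := Set.indicator_of_mem (Set.mem_univ y) _
    rw [map_apply, e, prod_rect, h, mul_one]

/-- This is Fubini's theorem: both orders of integration agree on rectangles, hence everywhere. -/
theorem map_swap_prod (ν : ContValuation X) (ρ : ContValuation Y) :
    map ContinuousMap.prodSwap (ν.prod ρ) = ρ.prod ν :=
  ext_rect fun V U => by
    have e : (Opens.rect V U).comap ContinuousMap.prodSwap = Opens.rect U V :=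
      Opens.ext (Set.ext fun _ => and_comm)
    rw [map_apply, e, prod_rect, prod_rect, mul_comm]

end Product

end ContValuation

/-! ### Monoidal structures and the support transformation -/

/-- The symmetric monoidal structure of `V` given by the Dirac valuations and the product
valuations. -/
@[reducible]
noncomputable def valuationLaxBraided : valuationMonad.{u}.toFunctor.LaxBraided where
  ε := valuationMonad.η.app (𝟙_ TopCat)
  μ X Y := valuationStrength.nabla X Y
  μ_natural_left f X' := TopCat.hom_ext <| ContinuousMap.ext fun p =>
    ContValuation.prod_map_map f.hom (ContinuousMap.id X') p.1 p.2
  μ_natural_right X' f := TopCat.hom_ext <| ContinuousMap.ext fun p =>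
    ContValuation.prod_map_map (ContinuousMap.id X') f.hom p.1 p.2
  associativity X Y Z := TopCat.hom_ext <| ContinuousMap.ext fun p =>
    ContValuation.map_assoc_prod (α_ X Y Z).hom.hom (fun _ => rfl) p.1.1 p.1.2 p.2
  left_unitality X := TopCat.hom_ext <| ContinuousMap.ext fun p =>
    (ContValuation.map_snd_prod_dirac p.1 p.2).symm
  right_unitality X := TopCat.hom_ext <| ContinuousMap.ext fun p =>
    (ContValuation.map_fst_prod_dirac p.1 p.2).symm
  braided X Y := TopCat.hom_ext <| ContinuousMap.ext fun p =>
    ContValuation.map_swap_prod p.1 p.2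

/-- The symmetric monoidal structure of `H` given by the closures of points and the products of
closed sets. -/
@[reducible]
def hyperspaceLaxBraided : hyperspaceMonad.{u}.toFunctor.LaxBraided where
  ε := hyperspaceMonad.η.app (𝟙_ TopCat)
  μ X Y := hyperspaceStrength.nabla X Y
  μ_natural_left f X' := TopCat.hom_ext <| ContinuousMap.ext fun p =>
    -- Unlike for valuations, pushforward along the identity takes a closure, so it is not
    -- definitionally trivial and has to be inserted by hand.
    (congrArg (Hyperspace.prod (Hyperspace.map f.hom p.1)) (Hyperspace.map_id p.2).symm).trans
      (Hyperspace.prod_map_map f.hom (ContinuousMap.id X') p.1 p.2)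
  μ_natural_right X' f := TopCat.hom_ext <| ContinuousMap.ext fun p =>
    (congrArg (Hyperspace.prod · (Hyperspace.map f.hom p.2)) (Hyperspace.map_id p.1).symm).trans
      (Hyperspace.prod_map_map (ContinuousMap.id X') f.hom p.1 p.2)
  associativity X Y Z := TopCat.hom_ext <| ContinuousMap.ext fun p =>
    Hyperspace.map_assoc_prod (α_ X Y Z).hom.hom (fun _ => rfl) p.1.1 p.1.2 p.2
  left_unitality X := TopCat.hom_ext <| ContinuousMap.ext fun p =>
    (Hyperspace.map_snd_prod_point p.1 p.2).symm
  right_unitality X := TopCat.hom_ext <| ContinuousMap.ext fun p =>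
    (Hyperspace.map_fst_prod_point p.1 p.2).symm
  braided X Y := TopCat.hom_ext <| ContinuousMap.ext fun p =>
    Hyperspace.map_swap_prod p.1 p.2

theorem ContValuation.support_dirac {X : Type u} [TopologicalSpace X] (x : X) :
    (dirac x).support = Hyperspace.point x :=
  Hyperspace.ext_hit fun U => by
    rw [support_mem_hit, Hyperspace.point_mem_hit]
    change 0 < ind U x ↔ x ∈ U
    by_cases h : x ∈ U <;> simp [ind, h]

theorem isMonoidal_supp :
    letI := valuationLaxBraided.{u}
    letI := hyperspaceLaxBraided.{u}
    NatTrans.IsMonoidal supp.{u} :=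
  letI := valuationLaxBraided.{u}
  letI := hyperspaceLaxBraided.{u}
  { unit := TopCat.hom_ext <| ContinuousMap.ext fun x => ContValuation.support_dirac x
    tensor := fun X Y => TopCat.hom_ext <| ContinuousMap.ext fun p =>
      ContValuation.support_prod p.1 p.2 }

/-- Every natural transformation is opmonoidal for the structures induced by the product
projections. -/
theorem isOpmonoidal_of_cartesian {C D : Type*} [Category C] [CartesianMonoidalCategory C]
    [Category D] [CartesianMonoidalCategory D] {F G : C ⥤ D} [F.OplaxMonoidal] [G.OplaxMonoidal]
    (τ : F ⟶ G) : IsOpmonoidal τ where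
  counit := CartesianMonoidalCategory.toUnit_unique _ _
  comul X Y := by
    ext
    -- Composed with a projection, each comultiplication becomes the functor applied to that
    -- projection, which leaves a naturality square of `τ`.
    · simp
    · simp

theorem mainTheorem2 :
    -- the support commutes with the strengths of `V` and `H`
    (∀ X Y : TopCat.{u},
      valuationStrength.str X Y ≫ supp.app (X ⊗ Y) =
        X ◁ supp.app Y ≫ hyperspaceStrength.str X Y) ∧
    -- for the symmetric monoidal structures of `V` and `H` given by the monad units and by `∇`,
    -- the support is a monoidal natural transformation
    (∃ (_ : valuationMonad.{u}.toFunctor.LaxBraided) (_ : hyperspaceMonad.{u}.toFunctor.LaxBraided),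
      Functor.LaxMonoidal.ε valuationMonad.{u}.toFunctor = valuationMonad.{u}.η.app (𝟙_ TopCat) ∧
      Functor.LaxMonoidal.ε hyperspaceMonad.{u}.toFunctor = hyperspaceMonad.{u}.η.app (𝟙_ TopCat) ∧
      (∀ X Y : TopCat.{u},
        Functor.LaxMonoidal.μ valuationMonad.toFunctor X Y = valuationStrength.nabla X Y) ∧
      (∀ X Y : TopCat.{u},
        Functor.LaxMonoidal.μ hyperspaceMonad.toFunctor X Y = hyperspaceStrength.nabla X Y) ∧
      NatTrans.IsMonoidal supp.{u}) ∧
    -- the support of a product valuation is the product of the supports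
    (∀ (X Y : Type u) [TopologicalSpace X] [TopologicalSpace Y]
      (ν : ContValuation X) (ρ : ContValuation Y),
      ((ν.prod ρ).support : Set (X × Y)) = (ν.support : Set X) ×ˢ (ρ.support : Set Y)) ∧
    -- the support is an opmonoidal natural transformation
    IsOpmonoidal supp.{u} ∧
    -- the supports of the marginals are the (closed) projections of the support
    (∀ (X Y : Type u) [TopologicalSpace X] [TopologicalSpace Y] (π : ContValuation (X × Y)),
      ((π.map ContinuousMap.fst).support : Set X) =
        closure (Prod.fst '' (π.support : Set (X × Y))) ∧
      ((π.map ContinuousMap.snd).support : Set Y) =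
        closure (Prod.snd '' (π.support : Set (X × Y)))) := by
  -- The first claim is naturality of the support at the slice inclusion that defines both
  -- strengths.
  refine ⟨fun X Y => TopCat.hom_ext <| ContinuousMap.ext fun p =>
      ContValuation.support_map (ContValuation.slice p.1) p.2,
    ⟨valuationLaxBraided, hyperspaceLaxBraided, rfl, rfl, fun _ _ => rfl, fun _ _ => rfl,
      isMonoidal_supp⟩,
    fun _ _ _ _ ν ρ => ContValuation.coe_support_prod ν ρ, isOpmonoidal_of_cartesian supp,
    fun _ _ _ _ π => ⟨?_, ?_⟩⟩
  -- Naturality at the projection; the pushforward of a closed set is by definition the closure of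
  -- its image.
  · rw [ContValuation.support_map]; rfl
  · rw [ContValuation.support_map]; rfl
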